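/- There exist absolute constants $C>0$ and $0<\epsilon_0<1$ such that for every fixed $\epsilon$ with $0<\epsilon<\epsilon_0$ the following holds. Let $p=\frac{1+\epsilon}{n}$, and let $G(n,p)$ be the binomial random graph on $n$ vertices, in which each of the $\binom n2$ possible edges is present independently with probability $p$. Then $$\mathbb{P}\left(\mathrm{rw}(G(n,p)) \ge C\,\frac{\epsilon^3}{\left(\log\frac1\epsilon\right)^3}\,n\right)\longrightarrow 1\qquad (n\to\infty),$$ where $\log$ is the natural logarithm and $\mathrm{rw}$ denotes rank-width: for a finite graph $G$ with at least two vertices, $\mathrm{rw}(G)$ is the minimum, over all pairs $(T,f)$ consisting of a finite tree $T$ in which every vertex has degree one or three and a bijection $f$ from $V(G)$ to the set of leaves of $T$, of the maximum over the edges $uv$ of $T$ of the rank over $\mathbb{F}_2$ of the matrix $\left(\mathbf 1[ab\in E(G)]\right)_{a\in A_{uv},\,b\in B_{uv}}$; here $A_{uv}=f^{-1}(C_u)$ and $B_{uv}=f^{-1}(C_v)$, with $C_u$ and $C_v$ the components of $T-uv$ containing $u$ and $v$ respectively. -/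

import Mathlib

open MeasureTheory ProbabilityTheory Filter Topology

namespace SimpleGraph

open Classical in
/-- The cut-rank of two vertex sets `A` and `B` in `G`: the rank over the field with two elements
of the `A × B` submatrix of the adjacency matrix. -/
noncomputable def cutRank {V : Type*} [Fintype V] (G : SimpleGraph V) (A B : Set V) : ℕ :=
  ((G.adjMatrix (ZMod 2)).submatrix (Subtype.val : A → V) (Subtype.val : B → V)).rank

open Classical in
/-- A rank-decomposition of a graph with vertex set `V`: a finite tree in which every vertex has
degree one or three, with a bijection from `V` to its leaves (the vertices of degree one). -/
structure RankDecomposition (V : Type*) where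
  /-- The vertices of the tree. -/
  Node : Type
  [fintypeNode : Fintype Node]
  /-- The tree. -/
  tree : SimpleGraph Node
  isTree : tree.IsTree
  subcubic : ∀ x, tree.degree x = 1 ∨ tree.degree x = 3
  /-- The bijection from `V` to the set of leaves. -/
  leafEquiv : V ≃ {x : Node // tree.degree x = 1}

attribute [instance] RankDecomposition.fintypeNode

namespace RankDecomposition

variable {V : Type*}

/-- The elements of `V` whose leaves lie in the component of `u` after the edge `uv` of the tree
is deleted. -/
def side (D : RankDecomposition V) (u v : D.Node) : Set V :=
  {x | (D.tree.deleteEdges {s(u, v)}).Reachable u (D.leafEquiv x : D.Node)}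

open Classical in
/-- The width of a rank-decomposition with respect to `G`: the maximum over the edges `uv` of the
tree of the cut-rank of the induced bipartition of the vertices of `G` (an edge appears here with
both of its orientations, which give the same value). -/
noncomputable def width [Fintype V] (D : RankDecomposition V) (G : SimpleGraph V) : ℕ :=
  Finset.univ.sup fun d : D.tree.Dart => G.cutRank (D.side d.fst d.snd) (D.side d.snd d.fst)

end RankDecomposition

/-- The rank-width of a finite graph: the minimum width of a rank-decomposition. Graphs with at
most one vertex have no rank-decomposition, and then the value is `0`, as is customary. -/
noncomputable def rankWidth {V : Type*} [Fintype V] (G : SimpleGraph V) : ℕ :=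
  sInf (Set.range fun D : RankDecomposition V => D.width G)

end SimpleGraph

/-! The random graph is exposed in two rounds, with `p₁ * n ≥ 1 + ε / 2` and `p₂ = ε / (2 * n)`. The
aim is a set `W` of order `ε n` vertices such that every cut with at least a third of `W` on each
side has order `ε³ n` edges. Every rank-decomposition displays such a cut
(`RankDecomposition.exists_balanced`).

`W` is the set of vertices whose first-round component has at least `s`, of order `1 / ε²`,
vertices. It is large because `a` given vertices all lie in small components with probability at
most `(1 - ε / 4) ^ a` (`bernoulliProb_confined_le`), whereas a small `W` would leave too many such
`a`-sets.

The `2 ^ |W|` cuts of `W` are too many for a union bound, since the second round only yields an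
exponent of order `ε² |W|`. Cutting a depth-first tour of each big component into blocks of `s`
steps gives `O(|W| / s)` groups, and a cut with few edges splits few of them (`exists_grouping`). Up
to a small loss, a cut is therefore a choice of groups, and the second round beats the number of
choices (`bernoulliProb_small_cut_le`).

Edges become rank because a matrix with at most `d` nonzero entries per row and column has rank at
least their total number over `d²` (`Matrix.card_ne_zero_le_rank`). Degrees are unbounded, but any
`ε⁴ n` vertices meet only `O(ε⁴ n log (1 / ε))` edges, which is negligible against `ε³ n`, so
vertices of degree beyond `O(log (1 / ε))` can be dropped (`crossCount_le_cutRank`). -/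

namespace Finset

/-! ### Random subsets with independent elements -/

variable {α : Type*}

/-- The expectation of `f S`, where `S` is a random subset of `E` containing each element
independently with probability `p`. -/
noncomputable def bernoulliExp (E : Finset α) (p : ℝ) (f : Finset α → ℝ) : ℝ :=
  ∑ S ∈ E.powerset, p ^ S.card * (1 - p) ^ (E.card - S.card) * f S

/-- The probability of `P S`, where `S` is a random subset of `E` containing each element
independently with probability `p`. -/
noncomputable def bernoulliProb (E : Finset α) (p : ℝ) (P : Finset α → Prop) : ℝ :=
  bernoulliExp E p (Set.indicator {S | P S} 1)

variable {E F : Finset α} {p : ℝ} {f g : Finset α → ℝ} {P Q : Finset α → Prop}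

@[simp]
lemma bernoulliExp_empty : bernoulliExp ∅ p f = f ∅ := by simp [bernoulliExp]

/-- Conditioning on whether `e` is chosen. The product and sprinkling identities below follow from
it by induction on `E`. -/
lemma bernoulliExp_insert [DecidableEq α] {e : α} (he : e ∉ E) :
    bernoulliExp (insert e E) p f =
      (1 - p) * bernoulliExp E p f + p * bernoulliExp E p (fun S => f (insert e S)) := by
  unfold bernoulliExp
  rw [sum_powerset_insert he, mul_sum, mul_sum]
  congr 1 <;> refine sum_congr rfl fun S hS => ?_
  · rw [mem_powerset] at hS
    rw [card_insert_of_notMem he, Nat.succ_sub (card_le_card hS), pow_succ]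
    ring
  · rw [mem_powerset] at hS
    rw [card_insert_of_notMem he, card_insert_of_notMem (fun h => he (hS h)), Nat.add_sub_add_right,
      pow_succ]
    ring

lemma bernoulliExp_mono (hp0 : 0 ≤ p) (hp1 : p ≤ 1) (h : ∀ S ⊆ E, f S ≤ g S) :
    bernoulliExp E p f ≤ bernoulliExp E p g := by
  refine sum_le_sum fun S hS => mul_le_mul_of_nonneg_left (h S (mem_powerset.1 hS)) ?_
  have : 0 ≤ 1 - p := by linarith
  positivity

lemma bernoulliExp_congr (h : ∀ S ⊆ E, f S = g S) : bernoulliExp E p f = bernoulliExp E p g :=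
  sum_congr rfl fun S hS => by rw [h S (mem_powerset.1 hS)]

lemma bernoulliExp_nonneg (hp0 : 0 ≤ p) (hp1 : p ≤ 1) (h : ∀ S ⊆ E, 0 ≤ f S) :
    0 ≤ bernoulliExp E p f := by
  refine sum_nonneg fun S hS => mul_nonneg ?_ (h S (mem_powerset.1 hS))
  have : 0 ≤ 1 - p := by linarith
  positivity

lemma bernoulliExp_const_mul (c : ℝ) :
    bernoulliExp E p (fun S => c * f S) = c * bernoulliExp E p f := by
  simp only [bernoulliExp, mul_sum]
  exact sum_congr rfl fun S _ => by ring

lemma bernoulliExp_add :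
    bernoulliExp E p (fun S => f S + g S) = bernoulliExp E p f + bernoulliExp E p g := by
  simp only [bernoulliExp, mul_add, sum_add_distrib]

lemma bernoulliExp_sum {ι : Type*} (I : Finset ι) (f : ι → Finset α → ℝ) :
    bernoulliExp E p (fun S => ∑ i ∈ I, f i S) = ∑ i ∈ I, bernoulliExp E p (f i) := by
  simp only [bernoulliExp, mul_sum]
  exact sum_comm

lemma bernoulliExp_const (c : ℝ) : bernoulliExp E p (fun _ => c) = c := by
  classical
  induction E using Finset.induction_on with
  | empty => simp
  | insert e E he ih => rw [bernoulliExp_insert he, ih]; ring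

lemma bernoulliExp_union [DecidableEq α] (h : Disjoint E F) :
    bernoulliExp (E ∪ F) p f =
      bernoulliExp E p (fun S => bernoulliExp F p (fun T => f (S ∪ T))) := by
  induction E using Finset.induction_on generalizing f with
  | empty => simp
  | insert e E he ih =>
    rw [disjoint_insert_left] at h
    rw [insert_union, bernoulliExp_insert (by simp [he, h.1]), bernoulliExp_insert he, ih h.2,
      ih h.2]
    simp only [insert_union]

/-- Exposing a random set in two independent rounds. -/
lemma bernoulliExp_sprinkle [DecidableEq α] {p₁ p₂ : ℝ} (h : 1 - p = (1 - p₁) * (1 - p₂)) :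
    bernoulliExp E p f =
      bernoulliExp E p₁ (fun S => bernoulliExp E p₂ (fun T => f (S ∪ T))) := by
  induction E using Finset.induction_on generalizing f with
  | empty => simp
  | insert e E he ih =>
    have hp : p = 1 - (1 - p₁) * (1 - p₂) := by linarith
    simp only [bernoulliExp_insert he, bernoulliExp_add, bernoulliExp_const_mul, insert_union,
      union_insert, insert_idem, ih]
    rw [hp]
    ring

/-- The generating function of the number of elements of `F` that are chosen. -/
lemma bernoulliExp_pow_card_inter [DecidableEq α] (hF : F ⊆ E) (z : ℝ) :
    bernoulliExp E p (fun S => z ^ (S ∩ F).card) = (1 - p + p * z) ^ F.card := by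
  induction E using Finset.induction_on generalizing F with
  | empty => simp [subset_empty.1 hF]
  | insert e E he ih =>
    rw [bernoulliExp_insert he]
    by_cases heF : e ∈ F
    · have hF' : F.erase e ⊆ E := fun x hx =>
        (mem_insert.1 (hF (mem_of_mem_erase hx))).resolve_left (ne_of_mem_erase hx)
      have key : ∀ S ⊆ E, S ∩ F = S ∩ F.erase e := fun S hS => by
        ext x
        simp only [mem_inter, mem_erase]
        refine ⟨fun h => ⟨h.1, ?_, h.2⟩, fun h => ⟨h.1, h.2.2⟩⟩
        rintro rfl
        exact he (hS h.1)
      have h1 : bernoulliExp E p (fun S => z ^ (S ∩ F).card) =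
          (1 - p + p * z) ^ (F.erase e).card := by
        rw [← ih hF']
        exact bernoulliExp_congr fun S hS => by rw [key S hS]
      have h2 : bernoulliExp E p (fun S => z ^ (insert e S ∩ F).card) =
          z * (1 - p + p * z) ^ (F.erase e).card := by
        rw [← ih hF', ← bernoulliExp_const_mul]
        refine bernoulliExp_congr fun S hS => ?_
        rw [insert_inter_of_mem heF, card_insert_of_notMem (fun h => he (hS (mem_inter.1 h).1)),
          key S hS, pow_succ, mul_comm]
      rw [h1, h2, ← card_erase_add_one heF, pow_succ]
      ring
    · have hF' : F ⊆ E := fun x hx =>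
        (mem_insert.1 (hF hx)).resolve_left (by rintro rfl; exact heF hx)
      simp only [insert_inter_of_notMem heF, ih hF']
      ring

lemma bernoulliProb_nonneg (hp0 : 0 ≤ p) (hp1 : p ≤ 1) : 0 ≤ bernoulliProb E p P :=
  bernoulliExp_nonneg hp0 hp1 fun _ _ => Set.indicator_nonneg (fun _ _ => zero_le_one) _

lemma bernoulliProb_le_bernoulliExp (hp0 : 0 ≤ p) (hp1 : p ≤ 1) (h0 : ∀ S ⊆ E, 0 ≤ f S)
    (h : ∀ S ⊆ E, P S → 1 ≤ f S) : bernoulliProb E p P ≤ bernoulliExp E p f := by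
  refine bernoulliExp_mono hp0 hp1 fun S hS => ?_
  by_cases hP : P S
  · simpa [hP] using h S hS hP
  · simpa [hP] using h0 S hS

lemma bernoulliProb_mono (hp0 : 0 ≤ p) (hp1 : p ≤ 1) (h : ∀ S ⊆ E, P S → Q S) :
    bernoulliProb E p P ≤ bernoulliProb E p Q :=
  bernoulliProb_le_bernoulliExp hp0 hp1
    (fun _ _ => Set.indicator_nonneg (fun _ _ => zero_le_one) _) fun S hS hP => by
      simp [h S hS hP]

lemma bernoulliProb_le_one (hp0 : 0 ≤ p) (hp1 : p ≤ 1) : bernoulliProb E p P ≤ 1 :=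
  (bernoulliProb_le_bernoulliExp hp0 hp1 (f := fun _ => 1) (fun _ _ => zero_le_one)
    fun _ _ _ => le_rfl).trans_eq (bernoulliExp_const 1)

lemma bernoulliProb_eq_zero (h : ∀ S ⊆ E, ¬ P S) : bernoulliProb E p P = 0 := by
  rw [bernoulliProb, bernoulliExp_congr (g := fun _ => 0), bernoulliExp_const]
  intro S hS
  simp [h S hS]

lemma bernoulliProb_or_le (hp0 : 0 ≤ p) (hp1 : p ≤ 1) :
    bernoulliProb E p (fun S => P S ∨ Q S) ≤ bernoulliProb E p P + bernoulliProb E p Q := by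
  simp only [bernoulliProb]
  rw [← bernoulliExp_add]
  refine bernoulliProb_le_bernoulliExp hp0 hp1 (fun S _ => ?_) fun S _ h => ?_
  · exact add_nonneg (Set.indicator_nonneg (fun _ _ => zero_le_one) _)
      (Set.indicator_nonneg (fun _ _ => zero_le_one) _)
  · by_cases h1 : P S <;> by_cases h2 : Q S <;> simp_all

lemma bernoulliProb_exists_le {ι : Type*} (I : Finset ι) (P : ι → Finset α → Prop)
    (hp0 : 0 ≤ p) (hp1 : p ≤ 1) :
    bernoulliProb E p (fun S => ∃ i ∈ I, P i S) ≤ ∑ i ∈ I, bernoulliProb E p (P i) := by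
  simp only [bernoulliProb]
  rw [← bernoulliExp_sum]
  have hnn : ∀ i S, 0 ≤ Set.indicator {S | P i S} (1 : Finset α → ℝ) S :=
    fun i S => Set.indicator_nonneg (fun _ _ => zero_le_one) _
  refine bernoulliProb_le_bernoulliExp hp0 hp1 (fun S _ => sum_nonneg fun i _ => hnn i S) ?_
  rintro S - ⟨i, hi, h⟩
  refine le_trans ?_ (single_le_sum (fun i _ => hnn i S) hi)
  simp [h]

/-- Chernoff bound for the upper tail. -/
lemma bernoulliProb_le_card_inter [DecidableEq α] (hp0 : 0 ≤ p) (hp1 : p ≤ 1) (hF : F ⊆ E)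
    {z : ℝ} (hz : 1 ≤ z) (t : ℕ) :
    bernoulliProb E p (fun S => t ≤ (S ∩ F).card) ≤ (1 - p + p * z) ^ F.card / z ^ t := by
  have hz0 : 0 < z := by linarith
  rw [div_eq_inv_mul, ← bernoulliExp_pow_card_inter hF, ← bernoulliExp_const_mul]
  refine bernoulliProb_le_bernoulliExp hp0 hp1 (fun S _ => by positivity) fun S _ h => ?_
  rw [← div_eq_inv_mul, one_le_div (by positivity)]
  exact pow_le_pow_right₀ hz h

/-- Chernoff bound for the lower tail. -/
lemma bernoulliProb_card_inter_le [DecidableEq α] (hp0 : 0 ≤ p) (hp1 : p ≤ 1) (hF : F ⊆ E)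
    {z : ℝ} (hz0 : 0 < z) (hz : z ≤ 1) (t : ℕ) :
    bernoulliProb E p (fun S => (S ∩ F).card ≤ t) ≤ (1 - p + p * z) ^ F.card / z ^ t := by
  rw [div_eq_inv_mul, ← bernoulliExp_pow_card_inter hF, ← bernoulliExp_const_mul]
  refine bernoulliProb_le_bernoulliExp hp0 hp1 (fun S _ => by positivity) fun S _ h => ?_
  rw [← div_eq_inv_mul, one_le_div (by positivity)]
  exact pow_le_pow_of_le_one hz0.le hz h

end Finset

/-! ### The binomial random graph as a random set of pairs -/

namespace SimpleGraph

open Finset unitInterval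

/-- The unordered pairs of distinct vertices. -/
def pairs (V : Type*) [Fintype V] [DecidableEq V] : Finset (Sym2 V) :=
  univ.filter fun e => ¬ e.IsDiag

lemma mem_pairs {V : Type*} [Fintype V] [DecidableEq V] {u v : V} :
    s(u, v) ∈ pairs V ↔ u ≠ v := by
  simp [pairs]

lemma card_pairs (V : Type*) [Fintype V] [DecidableEq V] :
    (pairs V).card = (Nat.card V).choose 2 := by
  rw [Nat.card_eq_fintype_card, ← Sym2.card_diagSet_compl, Fintype.card_subtype]
  simp [pairs]

/-- Only subadditivity of the measure over the finitely many bad graphs is used, so no measurability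
is needed. A lower bound is enough for a limit equal to `1`. -/
lemma binomialRandom_ge {V : Type*} [Fintype V] [DecidableEq V] (p : I)
    (T : Set (SimpleGraph V)) :
    ENNReal.ofReal (1 - bernoulliProb (pairs V) p (fun S => fromEdgeSet (S : Set (Sym2 V)) ∉ T)) ≤
      binomialRandom V p T := by
  classical
  have hsub : Tᶜ ⊆ ⋃ S ∈ (pairs V).powerset.filter (fun S : Finset (Sym2 V) => fromEdgeSet (S : Set (Sym2 V)) ∉ T),
      {fromEdgeSet (S : Set (Sym2 V))} := by
    intro G hG
    simp only [Set.mem_iUnion, Set.mem_singleton_iff, mem_filter, mem_powerset]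
    refine ⟨G.edgeFinset, ⟨fun e he => ?_, by simpa using hG⟩, by simp⟩
    simp only [pairs, mem_filter, mem_univ, true_and]
    exact G.not_isDiag_of_mem_edgeFinset he
  have hbad : binomialRandom V p Tᶜ ≤ ENNReal.ofReal
      (bernoulliProb (pairs V) p (fun S => fromEdgeSet (S : Set (Sym2 V)) ∉ T)) := by
    refine (measure_mono hsub).trans ((measure_biUnion_finset_le _ _).trans ?_)
    rw [bernoulliProb, bernoulliExp, ENNReal.ofReal_sum_of_nonneg, sum_filter]
    · refine sum_le_sum fun S hS => ?_
      split_ifs with h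
      · exact zero_le
      · have hS' : (fromEdgeSet (S : Set (Sym2 V))).edgeSet = (S : Set (Sym2 V)) := by
          rw [edgeSet_fromEdgeSet, sdiff_eq_left, Set.disjoint_left]
          intro e he
          have := mem_powerset.1 hS he
          simpa [pairs] using this
        rw [binomialRandom_singleton, hS', Set.ncard_coe_finset, ← card_pairs,
          Set.indicator_of_mem (by exact h), Pi.one_apply, mul_one,
          ENNReal.ofReal_mul (pow_nonneg p.2.1 _), ENNReal.ofReal_pow p.2.1,
          ENNReal.ofReal_pow (by linarith [p.2.2])]
        refine le_of_eq ?_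
        have key : ∀ q : I, ((unitInterval.toNNReal q : NNReal) : ENNReal) =
            ENNReal.ofReal (q : ℝ) := fun q => by
          rw [ENNReal.ofReal, ENNReal.coe_inj]
          exact NNReal.eq (by simp [q.2.1])
        rw [key, key, coe_symm_eq]
    · intro S _
      refine mul_nonneg (mul_nonneg (pow_nonneg p.2.1 _) (pow_nonneg (by linarith [p.2.2]) _)) ?_
      exact Set.indicator_nonneg (fun _ _ => zero_le_one) _
  have htot : (1 : ENNReal) ≤ binomialRandom V p T + binomialRandom V p Tᶜ := by
    rw [← measure_univ (μ := binomialRandom V p), ← Set.union_compl_self T]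
    exact measure_union_le _ _
  rw [ENNReal.ofReal_sub _ (bernoulliProb_nonneg p.2.1 p.2.2), ENNReal.ofReal_one]
  exact tsub_le_iff_right.2 (htot.trans (by gcongr))

end SimpleGraph

/-! ### Exploration of components and vertices in big components -/

namespace SimpleGraph

open Finset

variable {V : Type*} [DecidableEq V]

/-- The vertices reached from `A` through `U` along edges in `S` are at most `b` in number. -/
def Confined (A U : Finset V) (b : ℕ) (S : Finset (Sym2 V)) : Prop :=
  ∃ R, A ⊆ R ∧ R ⊆ A ∪ U ∧ R.card ≤ b ∧ ∀ u ∈ R, ∀ v ∈ U, v ∉ R → s(u, v) ∉ S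

/-- One exploration step: the neighbours `N` of `x` are forced into `R`, after which `x` can be
discarded, saving one unit of `b`. -/
lemma Confined.explore {A U : Finset V} {b : ℕ} {S : Finset (Sym2 V)} (h : Confined A U (b + 1) S)
    {x : V} (hx : x ∈ A) (hxU : x ∉ U) {N : Finset V} (hN : ∀ u ∈ N, u ∈ U ∧ s(x, u) ∈ S) :
    Confined (A.erase x ∪ N) (U \ N) b S := by
  obtain ⟨R, hAR, hRU, hb, hR⟩ := h
  have hNR : ∀ u ∈ N, u ∈ R := fun u hu => by
    by_contra huR
    exact hR x (hAR hx) u (hN u hu).1 huR (hN u hu).2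
  refine ⟨R.erase x, ?_, ?_, ?_, ?_⟩
  · intro u hu
    rw [mem_union, mem_erase] at hu
    rw [mem_erase]
    rcases hu with hu | hu
    · exact ⟨hu.1, hAR hu.2⟩
    · exact ⟨fun h => hxU (h ▸ (hN u hu).1), hNR u hu⟩
  · intro u hu
    rw [mem_erase] at hu
    have := hRU hu.2
    simp only [mem_union, mem_erase, Finset.mem_sdiff] at this ⊢
    tauto
  · rw [card_erase_of_mem (hAR hx)]
    omega
  · intro u hu v hv hvR
    rw [Finset.mem_sdiff] at hv
    refine hR u (mem_of_mem_erase hu) v hv.1 fun h => hvR ?_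
    exact mem_erase.2 ⟨fun h' => hxU (h' ▸ hv.1), h⟩

/-- `η ^ |A|` is a supermartingale for the exploration: processing a vertex multiplies it on average
by `η⁻¹ * (1 - p + p * η) ^ |U|`, at most `1` while `|U| ≥ n₀`. Each step removes one vertex from `A
∪ U` and one unit from `b`, so `hcard` persists; `E` shrinks to the pairs not yet exposed. -/
lemma bernoulliProb_confined_le {p η : ℝ} (hp0 : 0 ≤ p) (hp1 : p ≤ 1) (hη0 : 0 < η) (hη1 : η ≤ 1)
    {n₀ : ℕ} (hn₀ : (1 - p + p * η) ^ n₀ ≤ η) (b : ℕ) {A U : Finset V} (hAU : Disjoint A U)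
    (hcard : n₀ + b ≤ A.card + U.card) {E : Finset (Sym2 V)}
    (hE : ∀ a ∈ A ∪ U, ∀ u ∈ U, a ≠ u → s(a, u) ∈ E) :
    bernoulliProb E p (Confined A U b) ≤ η ^ A.card := by
  induction b generalizing A U E with
  | zero =>
    rcases A.eq_empty_or_nonempty with rfl | hA
    · simpa using bernoulliProb_le_one hp0 hp1
    · rw [bernoulliProb_eq_zero]
      · positivity
      · rintro S - ⟨R, hAR, -, hb, -⟩
        rw [Nat.le_zero, card_eq_zero] at hb
        exact hA.ne_empty (subset_empty.1 (hb ▸ hAR))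
  | succ b ih =>
    -- Too many active vertices exclude confinement; otherwise `hcard` gives `n₀ ≤ |U|`.
    by_cases hAb : b + 1 < A.card
    · rw [bernoulliProb_eq_zero]
      · positivity
      · rintro S - ⟨R, hAR, -, hb, -⟩
        exact absurd (card_le_card hAR) (by omega)
    rcases A.eq_empty_or_nonempty with rfl | ⟨x, hx⟩
    · simpa using bernoulliProb_le_one hp0 hp1
    have hxU : x ∉ U := Finset.disjoint_left.1 hAU hx
    set E₁ := U.image fun u => s(x, u) with hE₁
    have hE₁E : E₁ ⊆ E := by
      intro e he
      obtain ⟨u, hu, rfl⟩ := mem_image.1 he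
      exact hE x (mem_union_left _ hx) u hu fun h => hxU (h ▸ hu)
    have hinj : Set.InjOn (fun u => s(x, u)) (U : Set V) := fun u _ v _ h => by
      exact Sym2.congr_right.1 h
    have hbase : 1 - p + p * η ≤ 1 := by nlinarith
    have hbase0 : 0 ≤ 1 - p + p * η := by nlinarith
    -- The pairs from `x` to `U` are exposed first; the induction hypothesis handles the independent
    -- remainder.
    rw [bernoulliProb, ← union_sdiff_of_subset hE₁E, bernoulliExp_union disjoint_sdiff]
    calc bernoulliExp E₁ p (fun S => bernoulliExp (E \ E₁) p
          (fun T => Set.indicator {S | Confined A U (b + 1) S} 1 (S ∪ T)))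
        ≤ bernoulliExp E₁ p (fun S => η ^ (A.card - 1) * η ^ (S ∩ E₁).card) := by
          refine bernoulliExp_mono hp0 hp1 fun S hS => ?_
          rw [inter_eq_left.2 hS]
          set N := U.filter fun u => s(x, u) ∈ S with hN
          have hNU : N ⊆ U := filter_subset _ _
          have hSN : S = N.image fun u => s(x, u) := by
            ext e
            simp only [hN, mem_image, mem_filter]
            constructor
            · intro he
              obtain ⟨u, hu, rfl⟩ := mem_image.1 (hS he)
              exact ⟨u, ⟨hu, he⟩, rfl⟩
            · rintro ⟨u, ⟨_, he⟩, rfl⟩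
              exact he
          have hSc : S.card = N.card := by
            rw [hSN]
            exact card_image_of_injOn (hinj.mono (by exact_mod_cast hNU))
          have hdA : Disjoint (A.erase x) N :=
            (hAU.mono (erase_subset _ _) hNU)
          have hcA : (A.erase x ∪ N).card = A.card - 1 + S.card := by
            rw [card_union_of_disjoint hdA, card_erase_of_mem hx, hSc]
          have hApos : 0 < A.card := card_pos.2 ⟨x, hx⟩
          have hcU : (U \ N).card + N.card = U.card := card_sdiff_add_card_eq_card hNU
          rw [← pow_add, ← hcA]
          refine le_trans ?_ (ih (A := A.erase x ∪ N) (U := U \ N) (E := E \ E₁) ?_ ?_ ?_)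
          · refine bernoulliExp_mono hp0 hp1 fun T hT => ?_
            by_cases h : Confined A U (b + 1) (S ∪ T)
            · have h' := h.explore hx hxU (N := N) fun u hu =>
                ⟨hNU hu, mem_union_left _ (mem_filter.1 hu).2⟩
              have h'' : Confined (A.erase x ∪ N) (U \ N) b T := by
                obtain ⟨R, h1, h2, h3, h4⟩ := h'
                exact ⟨R, h1, h2, h3, fun u hu v hv hvR hm =>
                  h4 u hu v hv hvR (mem_union_right _ hm)⟩
              simp [h, h'']
            · rw [Set.indicator_of_notMem (by exact h)]
              exact Set.indicator_nonneg (fun _ _ => zero_le_one) _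
          · rw [disjoint_union_left]
            exact ⟨hAU.mono (erase_subset _ _) sdiff_subset, disjoint_sdiff⟩
          · rw [hcA, hSc]
            omega
          · intro a ha u hu hau
            rw [Finset.mem_sdiff]
            rw [Finset.mem_sdiff] at hu
            have hax : a ≠ x := by
              rintro rfl
              simp only [mem_union, mem_erase, Finset.mem_sdiff] at ha
              rcases ha with (ha | ha) | ha
              · exact ha.1 rfl
              · exact hxU (hNU ha)
              · exact hxU ha.1
            refine ⟨hE a ?_ u hu.1 hau, ?_⟩
            · simp only [mem_union, mem_erase, Finset.mem_sdiff] at ha ⊢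
              rcases ha with (ha | ha) | ha
              · exact Or.inl ha.2
              · exact Or.inr (hNU ha)
              · exact Or.inr ha.1
            · rw [hE₁, mem_image]
              rintro ⟨w, _, hw⟩
              rw [Sym2.eq_iff] at hw
              rcases hw with hw | hw
              · exact hax hw.1.symm
              · exact hxU (hw.1 ▸ hu.1)
      _ = η ^ (A.card - 1) * (1 - p + p * η) ^ U.card := by
          rw [bernoulliExp_const_mul, bernoulliExp_pow_card_inter subset_rfl, hE₁,
            card_image_of_injOn hinj]
      _ ≤ η ^ (A.card - 1) * η := by
          gcongr
          exact (pow_le_pow_of_le_one hbase0 hbase (by omega)).trans hn₀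
      _ = η ^ A.card := by
          rw [← pow_succ, Nat.sub_add_cancel (card_pos.2 ⟨x, hx⟩)]

variable [Fintype V]

open Classical in
/-- The vertices of `G` whose component has at least `s` vertices. -/
noncomputable def bigVerts (G : SimpleGraph V) (s : ℕ) : Finset V :=
  univ.filter fun v => s ≤ (univ.filter fun u => G.Reachable v u).card

open Classical in
lemma mem_bigVerts {G : SimpleGraph V} {s : ℕ} {v : V} :
    v ∈ bigVerts G s ↔ s ≤ (univ.filter fun u => G.Reachable v u).card := by
  simp [bigVerts]

/-- The witness is the union of the components of the vertices of `A`: no edge leaves it. -/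
lemma confined_of_forall_notMem_bigVerts {S : Finset (Sym2 V)} {s : ℕ} {A : Finset V}
    (hA : ∀ v ∈ A, v ∉ bigVerts (fromEdgeSet (S : Set (Sym2 V))) s) :
    Confined A Aᶜ (A.card * s) S := by
  classical
  set G := fromEdgeSet (S : Set (Sym2 V))
  refine ⟨A.biUnion fun v => univ.filter fun u => G.Reachable v u, ?_, ?_, ?_, ?_⟩
  · intro v hv
    exact mem_biUnion.2 ⟨v, hv, by simp⟩
  · simp
  · refine card_biUnion_le_card_mul _ _ _ fun v hv => ?_
    have := hA v hv
    rw [mem_bigVerts] at this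
    convert Nat.le_of_lt (not_le.1 this)
  · intro u hu v hv hvR hm
    obtain ⟨a, ha, hau⟩ := mem_biUnion.1 hu
    refine hvR (mem_biUnion.2 ⟨a, ha, ?_⟩)
    rw [mem_filter] at hau ⊢
    refine ⟨mem_univ _, hau.2.trans (Adj.reachable ?_)⟩
    rw [fromEdgeSet_adj]
    exact ⟨hm, fun h => hvR (h ▸ hu)⟩

/-- With few vertices in big components, there are many sets of `a` vertices that
lie in small components. -/
lemma bernoulliProb_card_bigVerts_lt {p η : ℝ} (hp0 : 0 ≤ p) (hp1 : p ≤ 1) (hη0 : 0 < η)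
    (hη1 : η ≤ 1) {n₀ : ℕ} (hn₀ : (1 - p + p * η) ^ n₀ ≤ η) {a s m : ℕ}
    (hcard : n₀ + a * s ≤ Fintype.card V) :
    m.choose a * bernoulliProb (pairs V) p
      (fun S => m ≤ (bigVerts (fromEdgeSet (S : Set (Sym2 V))) s)ᶜ.card) ≤
        (Fintype.card V).choose a * η ^ a := by
  have hbound : ∀ A ∈ (univ : Finset V).powersetCard a,
      bernoulliProb (pairs V) p (Confined A Aᶜ (a * s)) ≤ η ^ a := by
    intro A hA
    have hAc := (mem_powersetCard.1 hA).2
    rw [← hAc]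
    refine bernoulliProb_confined_le hp0 hp1 hη0 hη1 hn₀ _ disjoint_compl_right ?_ ?_
    · rw [card_add_card_compl, hAc]
      exact hcard
    · intro u _ v _ h
      exact mem_pairs.2 h
  -- Markov's inequality for the number of confined `a`-sets, which is at least `m.choose a` on the
  -- event in question.
  calc m.choose a * bernoulliProb (pairs V) p
          (fun S => m ≤ (bigVerts (fromEdgeSet (S : Set (Sym2 V))) s)ᶜ.card)
      ≤ bernoulliExp (pairs V) p (fun S => ∑ A ∈ (univ : Finset V).powersetCard a,
        Set.indicator {S | Confined A Aᶜ (a * s) S} 1 S) := by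
        rw [bernoulliProb, ← bernoulliExp_const_mul]
        refine bernoulliExp_mono hp0 hp1 fun S hS => ?_
        by_cases h : m ≤ (bigVerts (fromEdgeSet (S : Set (Sym2 V))) s)ᶜ.card
        · rw [Set.indicator_of_mem (by exact h), Pi.one_apply, mul_one]
          set Z := (bigVerts (fromEdgeSet (S : Set (Sym2 V))) s)ᶜ
          calc (m.choose a : ℝ) ≤ (Z.card.choose a : ℝ) := by
                exact_mod_cast Nat.choose_le_choose a h
            _ = ∑ A ∈ Z.powersetCard a, (1 : ℝ) := by simp
            _ ≤ ∑ A ∈ Z.powersetCard a, Set.indicator {S | Confined A Aᶜ (a * s) S} 1 S := by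
                refine sum_le_sum fun A hA => ?_
                rw [mem_powersetCard] at hA
                have : Confined A Aᶜ (a * s) S := by
                  rw [← hA.2]
                  exact confined_of_forall_notMem_bigVerts fun v hv =>
                    by simpa [Z] using hA.1 hv
                simp [this]
            _ ≤ _ := by
                refine sum_le_sum_of_subset_of_nonneg
                  (powersetCard_mono (subset_univ _)) fun A _ _ => ?_
                exact Set.indicator_nonneg (fun _ _ => zero_le_one) _
        · rw [Set.indicator_of_notMem (by exact h), mul_zero]
          exact sum_nonneg fun A _ => Set.indicator_nonneg (fun _ _ => zero_le_one) _
    _ = ∑ A ∈ (univ : Finset V).powersetCard a,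
        bernoulliProb (pairs V) p (Confined A Aᶜ (a * s)) := by
        rw [bernoulliExp_sum]
        rfl
    _ ≤ ∑ A ∈ (univ : Finset V).powersetCard a, η ^ a := sum_le_sum hbound
    _ = _ := by simp

end SimpleGraph

/-! ### Depth-first tours and the grouping of big components -/

namespace SimpleGraph

open Finset

variable {V : Type*} [DecidableEq V]

/-- An edge from `a` on the tour to `b` off it allows the detour `a, b, a`. Both darts are new
because `b` is; the length grows by two and the support by one. -/
lemma Walk.exists_extend_tour {G : SimpleGraph V} {r v : V} (w : G.Walk r r) (hw : w.darts.Nodup)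
    (hl : w.length + 2 = 2 * w.support.toFinset.card) (hr : G.Reachable r v)
    (hv : v ∉ w.support) :
    ∃ w' : G.Walk r r, w'.darts.Nodup ∧ w'.length + 2 = 2 * w'.support.toFinset.card ∧
      w'.support.toFinset.card = w.support.toFinset.card + 1 := by
  obtain ⟨q⟩ := hr
  obtain ⟨d, -, hd1, hd2⟩ := q.exists_boundary_dart {x | x ∈ w.support} (by simp) hv
  obtain ⟨⟨a, b⟩, h⟩ := d
  simp only [Set.mem_ofPred_eq] at hd1 hd2
  change G.Adj a b at h
  have hspec := w.take_spec hd1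
  set w₁ := w.takeUntil a hd1
  set w₂ := w.dropUntil a hd1
  have hsup : (w₁.append (cons h (cons h.symm w₂))).support.toFinset =
      insert b w.support.toFinset := by
    rw [← hspec]
    ext x
    simp only [List.mem_toFinset, mem_support_append_iff, support_cons, List.mem_cons,
      Finset.mem_insert]
    have := w₂.start_mem_support
    constructor
    · rintro (hx | rfl | rfl | hx) <;> tauto
    · tauto
  have hcard : (w₁.append (cons h (cons h.symm w₂))).support.toFinset.card =
      w.support.toFinset.card + 1 := by
    rw [hsup, card_insert_of_notMem (by simpa using hd2)]
  refine ⟨w₁.append (cons h (cons h.symm w₂)), ?_, ?_, hcard⟩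
  · have hdarts : w₁.darts ++ w₂.darts = w.darts := by rw [← hspec, darts_append]
    rw [darts_append, darts_cons, darts_cons]
    have hperm : List.Perm (w₁.darts ++ (⟨(a, b), h⟩ :: ⟨(b, a), h.symm⟩ :: w₂.darts))
        (⟨(a, b), h⟩ :: ⟨(b, a), h.symm⟩ :: w.darts) := by
      rw [← hdarts]
      exact List.perm_middle.trans (List.Perm.cons _ List.perm_middle)
    rw [hperm.nodup_iff, List.nodup_cons, List.nodup_cons]
    refine ⟨?_, ?_, hw⟩
    · rw [List.mem_cons, not_or]
      refine ⟨fun h' => h.ne (congrArg (fun d : G.Dart => d.fst) h'), fun h' => hd2 ?_⟩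
      exact w.dart_snd_mem_support_of_mem_darts h'
    · exact fun h' => hd2 (w.dart_fst_mem_support_of_mem_darts h')
  · rw [hcard]
    have hlen : w₁.length + w₂.length = w.length := by rw [← hspec, length_append]
    rw [length_append, length_cons, length_cons]
    omega

/-- A depth-first tour of a component, traversing each edge at most once in each direction. -/
lemma exists_tour [Fintype V] (G : SimpleGraph V) (r : V) :
    ∃ w : G.Walk r r, w.darts.Nodup ∧ w.length + 2 = 2 * w.support.toFinset.card ∧
      ∀ v, G.Reachable r v → v ∈ w.support := by
  by_contra! hcon
  have key : ∀ k : ℕ, ∃ w : G.Walk r r, w.darts.Nodup ∧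
      w.length + 2 = 2 * w.support.toFinset.card ∧ k ≤ w.support.toFinset.card := by
    intro k
    induction k with
    | zero => exact ⟨Walk.nil, by simp, by simp, by simp⟩
    | succ k ih =>
      obtain ⟨w, h1, h2, h3⟩ := ih
      obtain ⟨v, hv, hvw⟩ := hcon w h1 h2
      obtain ⟨w', h1', h2', h3'⟩ := w.exists_extend_tour h1 h2 hv hvw
      exact ⟨w', h1', h2', by omega⟩
  obtain ⟨w, -, -, h⟩ := key (Fintype.card V + 1)
  have := card_le_univ w.support.toFinset
  omega

lemma exists_change {P : ℕ → Prop} {a b : ℕ} (hab : a ≤ b) (ha : P a) (hb : ¬ P b) :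
    ∃ k, a ≤ k ∧ k < b ∧ P k ∧ ¬ P (k + 1) := by
  induction b, hab using Nat.le_induction with
  | base => exact absurd ha hb
  | succ b hab ih =>
    by_cases h : P b
    · exact ⟨b, hab, by omega, h, hb⟩
    · obtain ⟨k, h1, h2, h3⟩ := ih h
      exact ⟨k, h1, by omega, h3⟩

/-- The number of pairs in `X ×ˢ Y` that are adjacent in `G`. -/
noncomputable def crossCount (G : SimpleGraph V) (X Y : Finset V) : ℕ :=
  Set.ncard {e : V × V | e.1 ∈ X ∧ e.2 ∈ Y ∧ G.Adj e.1 e.2}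

/-- The vertices in big components can be grouped into few small groups such that a set of
vertices that splits many groups has a large edge boundary. -/
lemma exists_grouping [Fintype V] (G : SimpleGraph V) {s : ℕ} (hs : 0 < s) :
    ∃ g : V → V × ℕ, s * ((bigVerts G s).image g).card ≤ 3 * (bigVerts G s).card ∧
      (∀ i, ((bigVerts G s).filter fun v => g v = i).card ≤ s) ∧
      ∀ X : Finset V, {i | ∃ u v, g u = i ∧ g v = i ∧ u ∈ X ∧ v ∉ X}.ncard ≤
        2 * crossCount G X Xᶜ := by
  classical
  choose w hnd hlen hsup using exists_tour G
  -- One root per component, so that all its vertices refer to the same tour.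
  let r : V → V := fun v => (G.connectedComponentMk v).out
  have hr : ∀ v, G.Reachable (r v) v := fun v =>
    ConnectedComponent.exact (Quot.out_eq (G.connectedComponentMk v))
  have hrr : ∀ u v, G.Reachable u v → r u = r v := fun u v h => by
    simp only [r, ConnectedComponent.sound h]
  have hidx : ∀ v, ∃ i, (w (r v)).getVert i = v ∧ i ≤ (w (r v)).length := fun v =>
    Walk.mem_support_iff_exists_getVert.1 (hsup _ _ (hr v))
  choose idx hidx hidxl using hidx
  have hcomp : ∀ v, (w (r v)).support.toFinset = univ.filter fun u => G.Reachable (r v) u := by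
    intro v
    ext u
    simp only [List.mem_toFinset, mem_filter, mem_univ, true_and]
    exact ⟨fun h => ⟨(w (r v)).takeUntil u h⟩, hsup _ _⟩
  have hblock : ∀ {i j : ℕ}, i / s = j → j * s ≤ i ∧ i < (j + 1) * s := by
    rintro i j rfl
    exact ⟨Nat.div_mul_le_self _ _, Nat.lt_mul_of_div_lt (Nat.lt_succ_self _) hs⟩
  -- A group is a component together with a block of `s` consecutive times; `idx v` is one chosen
  -- visit of the tour to `v`.
  refine ⟨fun v => (r v, idx v / s), ?_, ?_, ?_⟩
  · have hsub : (bigVerts G s).image (fun v => (r v, idx v / s)) ⊆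
        ((bigVerts G s).image r).biUnion fun x =>
          (range ((w x).length / s + 1)).image fun j => (x, j) := by
      intro i hi
      obtain ⟨v, hv, rfl⟩ := mem_image.1 hi
      refine mem_biUnion.2 ⟨r v, mem_image_of_mem _ hv, mem_image_of_mem _ ?_⟩
      rw [mem_range, Nat.lt_succ_iff]
      exact Nat.div_le_div_right (hidxl v)
    -- A component with `c ≥ s` vertices has a tour of length `2c - 2`, and `s` times its number of
    -- blocks is at most `2c - 2 + s ≤ 3c`.
    have hfib : ∀ x ∈ (bigVerts G s).image r,
        s * ((w x).length / s + 1) ≤ 3 * ((bigVerts G s).filter fun v => r v = x).card := by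
      intro x hx
      obtain ⟨v, hv, rfl⟩ := mem_image.1 hx
      have hmem : ∀ u, G.Reachable v u → u ∈ bigVerts G s := by
        intro u hu
        rw [mem_bigVerts] at hv ⊢
        refine hv.trans (card_le_card fun z hz => ?_)
        rw [mem_filter] at hz ⊢
        exact ⟨mem_univ _, hu.symm.trans hz.2⟩
      have hC : ((bigVerts G s).filter fun u => r u = r v) =
          univ.filter fun u => G.Reachable (r v) u := by
        ext u
        simp only [mem_filter, mem_univ, true_and]
        refine ⟨fun h => h.2 ▸ hr u, fun h => ?_⟩
        have : G.Reachable v u := (hr v).symm.trans h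
        exact ⟨hmem u this, (hrr _ _ this).symm⟩
      have h1 := hlen (r v)
      rw [hcomp v] at h1
      rw [hC]
      have h2 : s ≤ (univ.filter fun u => G.Reachable (r v) u).card := by
        rw [mem_bigVerts] at hv
        refine hv.trans (card_le_card fun z hz => ?_)
        rw [mem_filter] at hz ⊢
        exact ⟨mem_univ _, (hr v).trans hz.2⟩
      have h3 := Nat.mul_div_le (w (r v)).length s
      rw [mul_add]
      omega
    calc s * ((bigVerts G s).image (fun v => (r v, idx v / s))).card
        ≤ s * ∑ x ∈ (bigVerts G s).image r, ((w x).length / s + 1) := by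
          gcongr
          refine (card_le_card hsub).trans (card_biUnion_le.trans (sum_le_sum fun x _ => ?_))
          exact card_image_le.trans (by simp)
      _ ≤ ∑ x ∈ (bigVerts G s).image r,
            3 * ((bigVerts G s).filter fun v => r v = x).card := by
          rw [mul_sum]
          exact sum_le_sum hfib
      _ = 3 * (bigVerts G s).card := by
          rw [← mul_sum, ← card_eq_sum_card_image]
  · rintro ⟨x, j⟩
    have : s = (Ico (j * s) ((j + 1) * s)).card := by
      rw [Nat.card_Ico, ← Nat.sub_mul]
      simp
    conv_rhs => rw [this]
    refine card_le_card_of_injOn idx ?_ ?_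
    · intro v hv
      have hv' := (mem_filter.1 hv).2
      rw [Prod.mk.injEq] at hv'
      have := hblock hv'.2
      simpa using this
    · intro u hu v hv huv
      have hu' := (mem_filter.1 hu).2
      have hv' := (mem_filter.1 hv).2
      rw [Prod.mk.injEq] at hu' hv'
      rw [← hidx u, ← hidx v, hu'.1, hv'.1, huv]
  · intro X
    -- Inside the block of a split group the tour crosses the cut, in one direction or the other;
    -- hence the factor two.
    set T : Set (V × V) := {e | e.1 ∈ X ∧ e.2 ∈ Xᶜ ∧ G.Adj e.1 e.2}
    have hT : (T ∪ Prod.swap '' T).ncard ≤ 2 * crossCount G X Xᶜ := by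
      refine (Set.ncard_union_le _ _).trans ?_
      rw [Set.ncard_image_of_injective _ Prod.swap_injective, two_mul]
      rfl
    refine le_trans ?_ hT
    have hstep : ∀ i ∈ {i : V × ℕ | ∃ u v, (r u, idx u / s) = i ∧ (r v, idx v / s) = i ∧
        u ∈ X ∧ v ∉ X}, ∃ k, k / s = i.2 ∧ k < (w i.1).length ∧ r i.1 = i.1 ∧
        ((w i.1).getVert k, (w i.1).getVert (k + 1)) ∈ T ∪ Prod.swap '' T := by
      rintro i ⟨u, v, hu, hv, huX, hvX⟩
      obtain ⟨x, j⟩ := i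
      rw [Prod.mk.injEq] at hu hv
      have hx : r x = x := by
        rw [← hu.1]
        exact hrr _ _ (hr u)
      have hu2 := hblock hu.2
      have hv2 := hblock hv.2
      have hdiv : ∀ k, j * s ≤ k → k < (j + 1) * s → k / s = j := fun k h1 h2 =>
        Nat.div_eq_of_lt_le h1 h2
      have hgu : (w x).getVert (idx u) = u := by rw [← hu.1, hidx]
      have hgv : (w x).getVert (idx v) = v := by rw [← hv.1, hidx]
      have hlu : idx u ≤ (w x).length := by rw [← hu.1]; exact hidxl u
      have hlv : idx v ≤ (w x).length := by rw [← hv.1]; exact hidxl v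
      rcases le_total (idx u) (idx v) with h | h
      · obtain ⟨k, h1, h2, h3, h4⟩ := exists_change (P := fun k => (w x).getVert k ∈ X) h
          (by rwa [hgu]) (by rwa [hgv])
        have hkl : k < (w x).length := by omega
        exact ⟨k, hdiv k (by omega) (by omega), hkl, hx,
          Or.inl ⟨h3, by simpa using h4, (w x).adj_getVert_succ hkl⟩⟩
      · obtain ⟨k, h1, h2, h3, h4⟩ := exists_change (P := fun k => (w x).getVert k ∉ X) h
          (by rwa [hgv]) (by rw [hgu]; exact not_not.2 huX)
        have hkl : k < (w x).length := by omega
        refine ⟨k, hdiv k (by omega) (by omega), hkl, hx, Or.inr ⟨(_, _), ⟨not_not.1 h4, ?_,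
          ((w x).adj_getVert_succ hkl).symm⟩, rfl⟩⟩
        simpa using h3
    choose! k hk1 hk2 hk3 hk4 using hstep
    -- The crossing dart determines the component, and, since the tour repeats no dart, the time and
    -- so the block.
    refine Set.ncard_le_ncard_of_injOn
      (fun i => ((w i.1).getVert (k i), (w i.1).getVert (k i + 1))) hk4 ?_ (Set.toFinite _)
    intro i hi i' hi' heq
    have h1 : i.1 = i'.1 := by
      rw [← hk3 i hi, ← hk3 i' hi']
      refine hrr _ _ ?_
      have e1 : G.Reachable i.1 ((w i.1).getVert (k i)) := ⟨(w i.1).take (k i)⟩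
      have e2 : G.Reachable i'.1 ((w i'.1).getVert (k i')) := ⟨(w i'.1).take (k i')⟩
      rw [Prod.mk.injEq] at heq
      rw [heq.1] at e1
      exact e1.trans e2.symm
    have hk2i := hk2 i hi
    have hk2i' := hk2 i' hi'
    have hk1i := hk1 i hi
    have hk1i' := hk1 i' hi'
    obtain ⟨x, j⟩ := i
    obtain ⟨x', j'⟩ := i'
    simp only at h1 heq hk2i hk2i' hk1i hk1i'
    subst h1
    set a := k (x, j)
    set b := k (x, j')
    have ha : a < (w x).darts.length := by rwa [Walk.length_darts]
    have hb : b < (w x).darts.length := by rwa [Walk.length_darts]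
    have hab : (w x).darts[a] = (w x).darts[b] := by
      rw [Walk.darts_getElem_eq_getVert, Walk.darts_getElem_eq_getVert]
      exact Dart.ext _ _ heq
    have : a = b := (List.Nodup.getElem_inj_iff (hnd x)).1 hab
    rw [← hk1i, ← hk1i', this]

end SimpleGraph

/-! ### Rank of sparse matrices -/

namespace Matrix

open Finset

/-- A sparse matrix over a field with many nonzero entries has large rank. -/
lemma card_ne_zero_le_rank {m n K : Type*} [Fintype m] [Fintype n] [Field K] (M : Matrix m n K)
    {d : ℕ} (hrow : ∀ i, {j | M i j ≠ 0}.ncard ≤ d) (hcol : ∀ j, {i | M i j ≠ 0}.ncard ≤ d) :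
    {e : m × n | M e.1 e.2 ≠ 0}.ncard ≤ d ^ 2 * M.rank := by
  classical
  simp only [Set.ncard_eq_toFinset_card', Set.toFinset_ofPred] at hrow hcol ⊢
  obtain ⟨t, htsub, htcard, htspan, -⟩ :=
    Submodule.exists_finset_span_eq_linearIndepOn K (Set.range M.row)
  rw [← rank_eq_finrank_span_row] at htcard
  -- A column that vanishes on the rows in the basis `t` vanishes on the whole row space.
  have hJ : (univ.filter fun j => ∃ i, M i j ≠ 0) ⊆
      t.biUnion fun v => univ.filter fun j => v j ≠ 0 := by
    intro j hj
    obtain ⟨i, hi⟩ := (mem_filter.1 hj).2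
    by_contra hcon
    simp only [mem_biUnion, mem_filter, mem_univ, true_and, not_exists, not_and, not_not] at hcon
    have hle : Submodule.span K (t : Set (n → K)) ≤ LinearMap.ker (LinearMap.proj j) :=
      Submodule.span_le.2 fun v hv => hcon v hv
    rw [htspan] at hle
    exact hi (hle (Submodule.subset_span ⟨i, rfl⟩))
  have hJc : (univ.filter fun j => ∃ i, M i j ≠ 0).card ≤ M.rank * d := by
    refine (card_le_card hJ).trans ?_
    rw [← htcard]
    refine card_biUnion_le_card_mul _ _ _ fun v hv => ?_
    obtain ⟨i, rfl⟩ := htsub hv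
    exact hrow i
  calc (univ.filter fun e : m × n => M e.1 e.2 ≠ 0).card
      ≤ ((univ.filter fun j => ∃ i, M i j ≠ 0).biUnion fun j =>
          (univ.filter fun i => M i j ≠ 0).image fun i => (i, j)).card := by
        refine card_le_card fun e he => ?_
        have := (mem_filter.1 he).2
        simp only [mem_biUnion, mem_filter, mem_univ, true_and, mem_image]
        exact ⟨e.2, ⟨e.1, this⟩, e.1, this, rfl⟩
    _ ≤ (univ.filter fun j => ∃ i, M i j ≠ 0).card * d :=
        card_biUnion_le_card_mul _ _ _ fun j _ => card_image_le.trans (hcol j)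
    _ ≤ M.rank * d * d := by gcongr
    _ = d ^ 2 * M.rank := by ring

end Matrix

/-! ### Cut-rank, and balanced edges of rank-decompositions -/

namespace SimpleGraph

open Finset

lemma cutRank_mono {V : Type*} [Fintype V] (G : SimpleGraph V) {A A' B B' : Set V} (hA : A' ⊆ A)
    (hB : B' ⊆ B) : G.cutRank A' B' ≤ G.cutRank A B := by
  classical
  unfold cutRank
  exact Matrix.rank_submatrix_le ((G.adjMatrix (ZMod 2)).submatrix (Subtype.val : A → V)
    (Subtype.val : B → V)) (fun x : A' => ⟨x, hA x.2⟩) (fun x : B' => ⟨x, hB x.2⟩)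

lemma ncard_le_cutRank {V : Type*} [Fintype V] (G : SimpleGraph V) (A B : Set V) {d : ℕ}
    (hA : ∀ v ∈ A, (G.neighborSet v).ncard ≤ d) (hB : ∀ v ∈ B, (G.neighborSet v).ncard ≤ d) :
    {e : V × V | e.1 ∈ A ∧ e.2 ∈ B ∧ G.Adj e.1 e.2}.ncard ≤ d ^ 2 * G.cutRank A B := by
  classical
  have key : ∀ M : Matrix A B (ZMod 2), (∀ i j, M i j ≠ 0 ↔ G.Adj i j) →
      {e : V × V | e.1 ∈ A ∧ e.2 ∈ B ∧ G.Adj e.1 e.2}.ncard ≤ d ^ 2 * M.rank := by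
    intro M hne
    have hrow : ∀ i : A, {j | M i j ≠ 0}.ncard ≤ d := fun i =>
      (Set.ncard_le_ncard_of_injOn Subtype.val (t := G.neighborSet i)
        (fun u hu => (hne i u).1 hu) Subtype.val_injective.injOn).trans (hA i i.2)
    have hcol : ∀ j : B, {i | M i j ≠ 0}.ncard ≤ d := fun j =>
      (Set.ncard_le_ncard_of_injOn Subtype.val (t := G.neighborSet j)
        (fun u hu => ((hne u j).1 hu).symm) Subtype.val_injective.injOn).trans (hB j j.2)
    refine le_trans ?_ (M.card_ne_zero_le_rank hrow hcol)
    refine (Set.ncard_le_ncard (t := (fun e : A × B => ((e.1 : V), (e.2 : V))) ''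
      {e : A × B | M e.1 e.2 ≠ 0}) ?_ (Set.toFinite _)).trans (Set.ncard_image_le (Set.toFinite _))
    rintro ⟨a, b⟩ ⟨ha, hb, hab⟩
    exact ⟨(⟨a, ha⟩, ⟨b, hb⟩), (hne _ _).2 hab, rfl⟩
  exact key _ fun i j => by simp [adjMatrix_apply]

section Tree

variable {N : Type*} {T : SimpleGraph N}

lemma Connected.reachable_deleteEdges_of_dist_lt (hT : T.Connected) {u v z : N}
    (h : T.dist z u < T.dist z v) : (T.deleteEdges {s(u, v)}).Reachable u z := by
  classical
  obtain ⟨p, hp⟩ := hT.exists_walk_length_eq_dist z u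
  have hv : v ∉ p.support := fun hv => by
    have h1 := dist_le (p.takeUntil v hv)
    have h2 := p.length_takeUntil_le_length hv
    omega
  have : ∀ e ∈ p.edges, e ∉ ({s(u, v)} : Set (Sym2 N)) := fun e he h' => by
    rw [Set.mem_singleton_iff] at h'
    subst h'
    exact hv (p.snd_mem_support_of_mem_edges he)
  exact (p.toDeleteEdges _ this).reachable.symm

/-- A shortest path to the nearer endpoint avoids the edge, and the edge is a bridge. Sides of tree
edges can thus be handled through distances. -/
lemma IsTree.reachable_deleteEdges_iff (hT : T.IsTree) {u v z : N} (huv : T.Adj u v) :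
    (T.deleteEdges {s(u, v)}).Reachable u z ↔ T.dist z u < T.dist z v := by
  refine ⟨fun h => ?_, hT.connected.reachable_deleteEdges_of_dist_lt⟩
  by_contra hlt
  have hne := hT.dist_ne_of_adj z huv
  have h' : (T.deleteEdges {s(v, u)}).Reachable v z :=
    hT.connected.reachable_deleteEdges_of_dist_lt (by omega)
  rw [Sym2.eq_swap] at h'
  have hb := isAcyclic_iff_forall_adj_isBridge.1 hT.isAcyclic huv
  exact (isBridge_iff.1 hb) (h.trans h'.symm)

end Tree

namespace RankDecomposition

variable {V : Type*}

lemma mem_side (D : RankDecomposition V) {u v : D.Node} (huv : D.tree.Adj u v) {x : V} :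
    x ∈ D.side u v ↔ D.tree.dist (D.leafEquiv x) u < D.tree.dist (D.leafEquiv x) v :=
  D.isTree.reachable_deleteEdges_iff huv

lemma side_swap (D : RankDecomposition V) {u v : D.Node} (huv : D.tree.Adj u v) :
    D.side v u = (D.side u v)ᶜ := by
  ext x
  rw [Set.mem_compl_iff, D.mem_side huv, D.mem_side huv.symm]
  have := D.isTree.dist_ne_of_adj (D.leafEquiv x : D.Node) huv
  omega

open Classical in
/-- A rank-decomposition has an edge that splits a given set of vertices in a balanced way. -/
lemma exists_balanced (D : RankDecomposition V) (W : Finset V) (hW : 3 ≤ W.card) :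
    ∃ u v, D.tree.Adj u v ∧ W.card ≤ 3 * (W.filter fun x => x ∈ D.side u v).card ∧
      W.card ≤ 3 * (W.filter fun x => x ∉ D.side u v).card := by
  set dst : D.Node → V → ℕ := fun c x => D.tree.dist (D.leafEquiv x) c with hdst
  have : Nonempty D.Node := D.isTree.connected.nonempty
  -- `c` is a median of `W`: if a branch at `c` held more than half of `W`, moving into it would
  -- lower the total distance.
  obtain ⟨c, -, hc⟩ := Finset.exists_min_image univ (fun c => ∑ x ∈ W, dst c x) univ_nonempty
  have hsplit : ∀ u v, (W.filter fun x => x ∈ D.side u v).card +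
      (W.filter fun x => x ∉ D.side u v).card = W.card := fun u v =>
    card_filter_add_card_filter_not _
  have hhalf : ∀ u, D.tree.Adj u c →
      2 * (W.filter fun x => x ∈ D.side u c).card ≤ W.card := by
    intro u huc
    have hsum : ∑ x ∈ W, dst u x + (W.filter fun x => x ∈ D.side u c).card =
        ∑ x ∈ W, dst c x + (W.filter fun x => x ∉ D.side u c).card := by
      rw [card_filter, card_filter, ← sum_add_distrib, ← sum_add_distrib]
      refine sum_congr rfl fun x _ => ?_
      have h1 := D.isTree.dist_eq_dist_add_one_of_adj (D.leafEquiv x : D.Node) huc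
      simp only [hdst, D.mem_side huc]
      split_ifs <;> omega
    have h1 := hc u (mem_univ _)
    have h2 := hsplit u c
    omega
  have hcover : ∀ x ∈ W, (D.leafEquiv x : D.Node) ≠ c →
      ∃ u, D.tree.Adj c u ∧ x ∈ D.side u c := by
    intro x _ hxc
    obtain ⟨p, hp⟩ := D.isTree.connected.exists_walk_length_eq_dist c (D.leafEquiv x : D.Node)
    cases p with
    | nil => exact absurd rfl hxc
    | @cons _ u _ h q =>
      refine ⟨u, h, (D.mem_side h.symm).2 ?_⟩
      have := dist_le q
      rw [Walk.length_cons] at hp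
      rw [dist_comm, dist_comm (v := c)]
      omega
  have hsum : (W.filter fun x => (D.leafEquiv x : D.Node) ≠ c).card ≤
      ∑ u ∈ D.tree.neighborFinset c, (W.filter fun x => x ∈ D.side u c).card := by
    refine le_trans (card_le_card fun x hx => ?_) card_biUnion_le
    rw [mem_filter] at hx
    obtain ⟨u, hu, hxu⟩ := hcover x hx.1 hx.2
    exact mem_biUnion.2 ⟨u, by simpa using hu, mem_filter.2 ⟨hx.1, hxu⟩⟩
  -- A leaf has one branch, which would hold at least `|W| - 1` and at most `|W| / 2` elements,
  -- contradicting `3 ≤ |W|`. With three branches, one holds at least a third of `W`, and at most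
  -- half.
  rcases D.subcubic c with hdeg | hdeg
  · exfalso
    rw [← card_neighborFinset_eq_degree, card_eq_one] at hdeg
    obtain ⟨u, hu⟩ := hdeg
    rw [hu, sum_singleton] at hsum
    have huc : D.tree.Adj c u := by
      rw [← mem_neighborFinset, hu]
      exact mem_singleton_self u
    have h1 := hhalf u huc.symm
    have h2 : (W.filter fun x => (D.leafEquiv x : D.Node) = c).card ≤ 1 := by
      refine card_le_one.2 fun x hx y hy => ?_
      rw [mem_filter] at hx hy
      exact D.leafEquiv.injective (Subtype.ext (hx.2.trans hy.2.symm))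
    have h3 := card_filter_add_card_filter_not (s := W) fun x => (D.leafEquiv x : D.Node) = c
    have h4 : (W.filter fun x => (D.leafEquiv x : D.Node) ≠ c).card =
        (W.filter fun x => ¬ (D.leafEquiv x : D.Node) = c).card := rfl
    omega
  · have hall : (W.filter fun x => (D.leafEquiv x : D.Node) ≠ c) = W := by
      refine filter_true_of_mem fun x _ h => ?_
      have := (D.leafEquiv x).2
      rw [h] at this
      omega
    rw [hall] at hsum
    rw [← card_neighborFinset_eq_degree] at hdeg
    obtain ⟨u, hu, hle⟩ : ∃ u ∈ D.tree.neighborFinset c,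
        W.card ≤ 3 * (W.filter fun x => x ∈ D.side u c).card := by
      by_contra! hcon
      have hlt : ∑ u ∈ D.tree.neighborFinset c, 3 * (W.filter fun x => x ∈ D.side u c).card <
          ∑ u ∈ D.tree.neighborFinset c, W.card :=
        sum_lt_sum_of_nonempty (card_pos.1 (by omega)) hcon
      rw [← mul_sum, sum_const, hdeg, smul_eq_mul] at hlt
      omega
    rw [mem_neighborFinset] at hu
    have h1 := hhalf u hu.symm
    have h2 := hsplit u c
    exact ⟨u, c, hu.symm, hle, by omega⟩

lemma cutRank_le_width [Fintype V] (D : RankDecomposition V) (G : SimpleGraph V) {u v : D.Node}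
    (huv : D.tree.Adj u v) : G.cutRank (D.side u v) (D.side v u) ≤ D.width G := by
  classical
  unfold width
  exact Finset.le_sup (f := fun d : D.tree.Dart =>
    G.cutRank (D.side d.fst d.snd) (D.side d.snd d.fst)) (b := ⟨(u, v), huv⟩) (mem_univ _)

end RankDecomposition

end SimpleGraph

/-! ### Existence of rank-decompositions, by caterpillars -/

namespace SimpleGraph

open Finset

/-- The parent of a node in the caterpillar. -/
def caterpillarParent (m : ℕ) : ℕ := 2 * (m / 2) - 1

/-- A caterpillar with `k + 2` leaves and `k` further vertices. -/
def caterpillar (k : ℕ) : SimpleGraph (Fin (2 * k + 2)) where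
  Adj x y := x ≠ y ∧ (caterpillarParent x = y ∨ caterpillarParent y = x)
  symm := ⟨fun _ _ h => ⟨h.1.symm, h.2.symm⟩⟩
  loopless := ⟨fun _ h => h.1 rfl⟩

lemma caterpillar_adj {k : ℕ} {x y : Fin (2 * k + 2)} : (caterpillar k).Adj x y ↔
    (x : ℕ) ≠ y ∧ (2 * ((x : ℕ) / 2) - 1 = y ∨ 2 * ((y : ℕ) / 2) - 1 = x) := by
  rw [ne_eq, ← Fin.ext_iff]
  rfl

/-- Parents of nonzero nodes are smaller, so all nodes reach `0`; each edge joins a nonzero node to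
its parent, so there are at most `2 * k + 1` edges. Truncated subtraction makes `0` its own parent,
which adjacency excludes. -/
lemma caterpillar_isTree (k : ℕ) : (caterpillar k).IsTree := by
  classical
  have hreach : ∀ m (hm : m < 2 * k + 2), (caterpillar k).Reachable ⟨m, hm⟩ ⟨0, by omega⟩ := by
    intro m
    induction m using Nat.strong_induction_on with
    | _ m ih =>
      intro hm
      rcases Nat.eq_zero_or_pos m with rfl | hpos
      · exact Reachable.refl _
      · have hlt : 2 * (m / 2) - 1 < m := by omega
        refine Reachable.trans (Adj.reachable ?_) (ih _ hlt (by omega))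
        rw [caterpillar_adj]
        exact ⟨hlt.ne', Or.inl rfl⟩
  have hconn : (caterpillar k).Connected :=
    { preconnected := fun x y => (hreach x x.2).trans (hreach y y.2).symm
      nonempty := ⟨⟨0, by omega⟩⟩ }
  rw [isTree_iff_connected_and_card]
  refine ⟨hconn, le_antisymm ?_ hconn.card_vert_le_card_edgeSet_add_one⟩
  have hsub : (caterpillar k).edgeSet ⊆ Set.range fun m : Fin (2 * k + 1) =>
      s((⟨m + 1, by omega⟩ : Fin (2 * k + 2)), ⟨2 * (((m : ℕ) + 1) / 2) - 1, by omega⟩) := by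
    have hpar : ∀ x y : Fin (2 * k + 2), (x : ℕ) ≠ y → 2 * ((x : ℕ) / 2) - 1 = y →
        s(x, y) ∈ Set.range fun m : Fin (2 * k + 1) =>
          s((⟨m + 1, by omega⟩ : Fin (2 * k + 2)), ⟨2 * (((m : ℕ) + 1) / 2) - 1, by omega⟩) := by
      intro x y hxy h
      have hx : 0 < (x : ℕ) := by omega
      refine ⟨⟨x - 1, by omega⟩, ?_⟩
      have h1 : ((x : ℕ) - 1) + 1 = x := by omega
      simp only [h1, h]
    intro e
    induction e using Sym2.ind with
    | _ x y =>
      rw [mem_edgeSet, caterpillar_adj]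
      rintro ⟨hxy, h | h⟩
      · exact hpar x y hxy h
      · rw [Sym2.eq_swap]
        exact hpar y x hxy.symm h
  have h1 := Set.ncard_le_ncard hsub (Set.toFinite _)
  have h2 : (Set.range fun m : Fin (2 * k + 1) =>
      s((⟨m + 1, by omega⟩ : Fin (2 * k + 2)),
        (⟨2 * (((m : ℕ) + 1) / 2) - 1, by omega⟩ : Fin (2 * k + 2)))).ncard ≤ 2 * k + 1 := by
    rw [← Set.image_univ]
    refine (Set.ncard_image_le (Set.toFinite _)).trans ?_
    rw [Set.ncard_univ, Nat.card_eq_fintype_card, Fintype.card_fin]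
  rw [Nat.card_coe_set_eq, Nat.card_eq_fintype_card, Fintype.card_fin]
  omega

open Classical in
lemma degree_caterpillar_of_leaf {k : ℕ} {x : Fin (2 * k + 2)}
    (hx : (x : ℕ) % 2 = 0 ∨ (x : ℕ) = 2 * k + 1) : (caterpillar k).degree x = 1 := by
  rw [← card_neighborFinset_eq_degree, card_eq_one]
  by_cases h0 : (x : ℕ) = 0
  · refine ⟨⟨1, by omega⟩, ?_⟩
    ext y
    rw [mem_neighborFinset, caterpillar_adj, mem_singleton, Fin.ext_iff]
    simp only
    omega
  · refine ⟨⟨2 * ((x : ℕ) / 2) - 1, by omega⟩, ?_⟩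
    ext y
    rw [mem_neighborFinset, caterpillar_adj, mem_singleton, Fin.ext_iff]
    simp only
    omega

open Classical in
lemma degree_caterpillar_of_not_leaf {k : ℕ} {x : Fin (2 * k + 2)}
    (hx : ¬ ((x : ℕ) % 2 = 0 ∨ (x : ℕ) = 2 * k + 1)) : (caterpillar k).degree x = 3 := by
  rw [← card_neighborFinset_eq_degree, card_eq_three]
  refine ⟨⟨2 * ((x : ℕ) / 2) - 1, by omega⟩, ⟨x + 1, by omega⟩, ⟨x + 2, by omega⟩, ?_, ?_, ?_, ?_⟩
  · rw [ne_eq, Fin.ext_iff]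
    simp only
    omega
  · rw [ne_eq, Fin.ext_iff]
    simp only
    omega
  · rw [ne_eq, Fin.ext_iff]
    simp only
    omega
  · ext y
    rw [mem_neighborFinset, caterpillar_adj, mem_insert, mem_insert, mem_singleton, Fin.ext_iff,
      Fin.ext_iff, Fin.ext_iff]
    simp only
    omega

open Classical in
lemma degree_caterpillar_eq_one_iff {k : ℕ} {x : Fin (2 * k + 2)} :
    (caterpillar k).degree x = 1 ↔ (x : ℕ) % 2 = 0 ∨ (x : ℕ) = 2 * k + 1 := by
  refine ⟨fun h => ?_, degree_caterpillar_of_leaf⟩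
  by_contra hx
  rw [degree_caterpillar_of_not_leaf hx] at h
  omega

/-- Ensures that the infimum defining `rankWidth` is attained, rather than being the default value
`0` of an empty infimum. -/
lemma RankDecomposition.nonempty_fin {n : ℕ} (hn : 2 ≤ n) :
    Nonempty (RankDecomposition (Fin n)) := by
  classical
  obtain ⟨k, rfl⟩ := Nat.exists_eq_add_of_le' hn
  let leaf : Fin (k + 2) → {x : Fin (2 * k + 2) // (caterpillar k).degree x = 1} := fun i =>
    if h : (i : ℕ) ≤ k then ⟨⟨2 * i, by omega⟩, degree_caterpillar_eq_one_iff.2 (Or.inl (by simp))⟩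
    else ⟨⟨2 * k + 1, by omega⟩, degree_caterpillar_eq_one_iff.2 (Or.inr rfl)⟩
  have hleaf : ∀ i, ((leaf i : Fin (2 * k + 2)) : ℕ) = if (i : ℕ) ≤ k then 2 * (i : ℕ)
      else 2 * k + 1 := by
    intro i
    simp only [leaf]
    split_ifs <;> rfl
  refine ⟨⟨Fin (2 * k + 2), caterpillar k, caterpillar_isTree k, fun x => ?_,
    Equiv.ofBijective leaf ⟨fun i j hij => ?_, fun x => ?_⟩⟩⟩
  · by_cases hx : (x : ℕ) % 2 = 0 ∨ (x : ℕ) = 2 * k + 1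
    · exact Or.inl (degree_caterpillar_of_leaf hx)
    · exact Or.inr (degree_caterpillar_of_not_leaf hx)
  · have h : ((leaf i : Fin (2 * k + 2)) : ℕ) = (leaf j : Fin (2 * k + 2)) := by rw [hij]
    rw [hleaf, hleaf] at h
    apply Fin.ext
    split_ifs at h <;> omega
  · obtain ⟨x, hx⟩ := x
    rw [degree_caterpillar_eq_one_iff] at hx
    by_cases hk : (x : ℕ) = 2 * k + 1
    · refine ⟨⟨k + 1, by omega⟩, Subtype.ext (Fin.ext ?_)⟩
      rw [hleaf]
      simp [hk]
    · refine ⟨⟨(x : ℕ) / 2, by omega⟩, Subtype.ext (Fin.ext ?_)⟩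
      rw [hleaf]
      simp only
      rw [if_pos (by omega)]
      omega

lemma RankDecomposition.exists_width_eq_rankWidth {n : ℕ} (hn : 2 ≤ n) (G : SimpleGraph (Fin n)) :
    ∃ D : RankDecomposition (Fin n), D.width G = G.rankWidth := by
  obtain ⟨D⟩ := RankDecomposition.nonempty_fin hn
  exact Nat.sInf_mem (s := Set.range fun D : RankDecomposition (Fin n) => D.width G) ⟨_, D, rfl⟩

end SimpleGraph

/-! ### Sprinkling: balanced cuts have many edges -/

namespace SimpleGraph

open Finset

variable {V : Type*} [DecidableEq V]

/-- The unordered pairs with one vertex in `Y` and the other one in `Z`. -/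
def crossPairs (Y Z : Finset V) : Finset (Sym2 V) := (Y ×ˢ Z).image fun e => s(e.1, e.2)

lemma injOn_crossPairs {V : Type*} {Y Z : Finset V} (h : Disjoint Y Z) :
    Set.InjOn (fun e : V × V => s(e.1, e.2)) {e | e.1 ∈ Y ∧ e.2 ∈ Z} := by
  rintro ⟨a, b⟩ ⟨ha, hb⟩ ⟨c, d⟩ ⟨hc, hd⟩ he
  rcases Sym2.eq_iff.1 he with ⟨h1, h2⟩ | ⟨h1, h2⟩
  · exact Prod.ext h1 h2
  · simp only at h1 h2 ha hb hc hd
    exact absurd (h1 ▸ ha) (fun h' => Finset.disjoint_left.1 h h' hd)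

lemma card_crossPairs {Y Z : Finset V} (h : Disjoint Y Z) :
    (crossPairs Y Z).card = Y.card * Z.card := by
  rw [crossPairs, card_image_of_injOn, card_product]
  refine (injOn_crossPairs h).mono fun e he => ?_
  simpa using he

lemma card_inter_crossPairs_le [Fintype V] {X Y Z : Finset V} {S S' : Finset (Sym2 V)}
    (hS : S ⊆ S') (hY : Y ⊆ X) (hZ : Z ⊆ Xᶜ) :
    (S ∩ crossPairs Y Z).card ≤ crossCount (fromEdgeSet (S' : Set (Sym2 V))) X Xᶜ := by
  rw [crossCount, ← Set.ncard_coe_finset]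
  refine (Set.ncard_le_ncard (t := (fun e : V × V => s(e.1, e.2)) ''
    {e : V × V | e.1 ∈ X ∧ e.2 ∈ Xᶜ ∧ (fromEdgeSet (S' : Set (Sym2 V))).Adj e.1 e.2}) ?_
    (Set.toFinite _)).trans (Set.ncard_image_le (Set.toFinite _))
  intro e he
  rw [mem_coe, mem_inter, crossPairs, mem_image] at he
  obtain ⟨heS, ⟨a, b⟩, hab, rfl⟩ := he
  rw [mem_product] at hab
  refine ⟨(a, b), ⟨hY hab.1, hZ hab.2, ?_⟩, rfl⟩
  rw [fromEdgeSet_adj]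
  refine ⟨hS heS, fun h => ?_⟩
  simp only at h
  exact mem_compl.1 (hZ hab.2) (h ▸ hY hab.1)

/-- `X` cuts `W` in a balanced way. -/
def Balanced (W X : Finset V) : Prop :=
  W.card ≤ 3 * (W.filter fun v => v ∈ X).card ∧ W.card ≤ 3 * (W.filter fun v => v ∉ X).card

/-- Split groups contain at most `2 * m * s ≤ |W| / 12` vertices, and `1 / 3 - 1 / 12 = 1 / 4`. -/
lemma card_filter_mem_le {ι : Type*} [DecidableEq ι] (W X : Finset V) (g : V → ι) (s m : ℕ)
    (hfib : ∀ i, (W.filter fun v => g v = i).card ≤ s) (B : Finset ι) (hB : B.card ≤ 2 * m)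
    (hsplit : ∀ u ∈ W, ∀ v ∈ W, g u = g v → u ∈ X → v ∉ X → g u ∈ B)
    (hm : 24 * m * s ≤ W.card) (hX : W.card ≤ 3 * (W.filter fun v => v ∈ X).card) :
    W.card ≤ 4 * (W.filter fun v => ∀ u ∈ W, g u = g v → u ∈ X).card := by
  have hsub : (W.filter fun v => v ∈ X) ⊆
      (W.filter fun v => ∀ u ∈ W, g u = g v → u ∈ X) ∪
        B.biUnion fun i => W.filter fun v => g v = i := by
    intro v hv
    rw [mem_filter] at hv
    rw [mem_union, mem_filter, mem_biUnion]
    by_cases h : ∀ u ∈ W, g u = g v → u ∈ X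
    · exact Or.inl ⟨hv.1, h⟩
    · push Not at h
      obtain ⟨u, hu, huv, huX⟩ := h
      exact Or.inr ⟨g v, hsplit v hv.1 u hu huv.symm hv.2 huX, mem_filter.2 ⟨hv.1, rfl⟩⟩
  have h1 := (card_le_card hsub).trans (card_union_le _ _)
  have h2 : (B.biUnion fun i => W.filter fun v => g v = i).card ≤ B.card * s :=
    card_biUnion_le_card_mul _ _ _ fun i _ => hfib i
  have h3 : B.card * s ≤ 2 * m * s := Nat.mul_le_mul_right s hB
  have h4 : 24 * m * s = 12 * (2 * m * s) := by ring
  omega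

lemma crossCount_mono {V : Type*} [Finite V] {G H : SimpleGraph V} (h : G ≤ H) (X Y : Finset V) :
    crossCount G X Y ≤ crossCount H X Y :=
  Set.ncard_le_ncard (fun _ he => ⟨he.1, he.2.1, h he.2.2⟩) (Set.toFinite _)

variable [Fintype V]

/-- After sprinkling, no balanced cut of the set of vertices in big components is small. -/
lemma bernoulliProb_small_cut_le {p : ℝ} (hp0 : 0 ≤ p) (hp1 : p ≤ 1) (S₁ : Finset (Sym2 V))
    {s m : ℕ} (hs : 0 < s)
    (hm : 24 * m * s ≤ (bigVerts (fromEdgeSet (S₁ : Set (Sym2 V))) s).card) :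
    ∃ M : ℕ, s * M ≤ 3 * (bigVerts (fromEdgeSet (S₁ : Set (Sym2 V))) s).card ∧
      bernoulliProb (pairs V) p (fun S₂ => ∃ X,
        Balanced (bigVerts (fromEdgeSet (S₁ : Set (Sym2 V))) s) X ∧
          crossCount (fromEdgeSet ((S₁ ∪ S₂ : Finset _) : Set (Sym2 V))) X Xᶜ ≤ m) ≤
      4 ^ M * 2 ^ m *
        Real.exp (-(p * (bigVerts (fromEdgeSet (S₁ : Set (Sym2 V))) s).card ^ 2 / 32)) := by
  classical
  set G := fromEdgeSet (S₁ : Set (Sym2 V))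
  set W := bigVerts G s
  obtain ⟨g, hgM, hfib, hsplit⟩ := exists_grouping G hs
  set I := W.image g
  refine ⟨I.card, hgM, ?_⟩
  -- The union bound runs over pairs of families of groups, at most `4 ^ |I|` of them, instead of
  -- over all `X`.
  set J := (I.powerset ×ˢ I.powerset).filter fun q =>
    Disjoint (W.filter fun v => g v ∈ q.1) (W.filter fun v => g v ∈ q.2) ∧
      W.card ≤ 4 * (W.filter fun v => g v ∈ q.1).card ∧
      W.card ≤ 4 * (W.filter fun v => g v ∈ q.2).card
  have hcover : ∀ S₂ ⊆ pairs V, (∃ X, Balanced W X ∧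
      crossCount (fromEdgeSet ((S₁ ∪ S₂ : Finset _) : Set (Sym2 V))) X Xᶜ ≤ m) →
      ∃ q ∈ J, (S₂ ∩ crossPairs (W.filter fun v => g v ∈ q.1)
        (W.filter fun v => g v ∈ q.2)).card ≤ m := by
    rintro S₂ - ⟨X, ⟨hX1, hX2⟩, hcut⟩
    -- The groups wholly inside `X` and those wholly outside.
    set q : Finset (V × ℕ) × Finset (V × ℕ) :=
      (I.filter fun i => ∀ u ∈ W, g u = i → u ∈ X, I.filter fun i => ∀ u ∈ W, g u = i → u ∈ Xᶜ)
    have hq1 : (W.filter fun v => g v ∈ q.1) = W.filter fun v => ∀ u ∈ W, g u = g v → u ∈ X := by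
      refine filter_congr fun v hv => ?_
      simp only [q, mem_filter]
      exact ⟨fun h => h.2, fun h => ⟨mem_image_of_mem g hv, h⟩⟩
    have hq2 : (W.filter fun v => g v ∈ q.2) = W.filter fun v => ∀ u ∈ W, g u = g v → u ∈ Xᶜ := by
      refine filter_congr fun v hv => ?_
      simp only [q, mem_filter]
      exact ⟨fun h => h.2, fun h => ⟨mem_image_of_mem g hv, h⟩⟩
    have hY : (W.filter fun v => g v ∈ q.1) ⊆ X := by
      rw [hq1]
      intro v hv
      exact (mem_filter.1 hv).2 v (mem_filter.1 hv).1 rfl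
    have hZ : (W.filter fun v => g v ∈ q.2) ⊆ Xᶜ := by
      rw [hq2]
      intro v hv
      exact (mem_filter.1 hv).2 v (mem_filter.1 hv).1 rfl
    have hGle : G ≤ fromEdgeSet ((S₁ ∪ S₂ : Finset _) : Set (Sym2 V)) :=
      fromEdgeSet_mono (by simp)
    have hsp : {i | ∃ u v, g u = i ∧ g v = i ∧ u ∈ X ∧ v ∉ X}.ncard ≤ 2 * m := by
      refine (hsplit X).trans ?_
      have := (crossCount_mono hGle X Xᶜ).trans hcut
      omega
    have hfin : {i | ∃ u v, g u = i ∧ g v = i ∧ u ∈ X ∧ v ∉ X}.Finite := by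
      refine (Set.finite_range g).subset ?_
      rintro i ⟨u, -, hu, -⟩
      exact ⟨u, hu⟩
    rw [Set.ncard_eq_toFinset_card _ hfin] at hsp
    refine ⟨q, mem_filter.2 ⟨?_, ?_, ?_, ?_⟩,
      (card_inter_crossPairs_le subset_union_right hY hZ).trans hcut⟩
    · rw [mem_product, mem_powerset, mem_powerset]
      exact ⟨filter_subset _ _, filter_subset _ _⟩
    · exact disjoint_compl_right.mono hY hZ
    · rw [hq1]
      convert card_filter_mem_le W X g s m hfib hfin.toFinset hsp ?_ hm hX1
      intro u _ v _ huv hu hv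
      rw [Set.Finite.mem_toFinset]
      exact ⟨u, v, rfl, huv.symm, hu, hv⟩
    · rw [hq2]
      convert card_filter_mem_le W Xᶜ g s m hfib hfin.toFinset hsp ?_ hm (by simpa using hX2)
      intro u _ v _ huv hu hv
      rw [Set.Finite.mem_toFinset]
      rw [mem_compl] at hu
      rw [mem_compl, not_not] at hv
      exact ⟨v, u, huv.symm, rfl, hv, hu⟩
  have hterm : ∀ q ∈ J, bernoulliProb (pairs V) p (fun S₂ =>
      (S₂ ∩ crossPairs (W.filter fun v => g v ∈ q.1) (W.filter fun v => g v ∈ q.2)).card ≤ m) ≤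
        2 ^ m * Real.exp (-(p * W.card ^ 2 / 32)) := by
    intro q hq
    obtain ⟨hdisj, h1, h2⟩ := (mem_filter.1 hq).2
    have hsub : crossPairs (W.filter fun v => g v ∈ q.1) (W.filter fun v => g v ∈ q.2) ⊆
        pairs V := by
      intro e he
      rw [crossPairs, mem_image] at he
      obtain ⟨⟨a, b⟩, hab, rfl⟩ := he
      rw [mem_product] at hab
      rw [mem_pairs]
      exact fun h => Finset.disjoint_left.1 hdisj hab.1 (h ▸ hab.2)
    refine (bernoulliProb_card_inter_le hp0 hp1 hsub (z := 1 / 2) (by norm_num) (by norm_num)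
      m).trans ?_
    rw [card_crossPairs hdisj, div_eq_mul_inv, ← inv_pow, mul_comm]
    norm_num only
    refine mul_le_mul_of_nonneg_left ?_ (by positivity)
    set y := (W.filter fun v => g v ∈ q.1).card
    set z := (W.filter fun v => g v ∈ q.2).card
    have hb : 1 - p + p * (1 / 2) ≤ Real.exp (-(p / 2)) := by
      have := Real.add_one_le_exp (-(p / 2))
      linarith
    calc (1 - p + p * (1 / 2)) ^ (y * z) ≤ Real.exp (-(p / 2)) ^ (y * z) :=
          pow_le_pow_left₀ (by linarith) hb _
      _ = Real.exp (-(p * (y * z) / 2)) := by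
          rw [← Real.exp_nat_mul]
          push_cast
          ring_nf
      _ ≤ _ := by
          have h1' : (W.card : ℝ) ≤ 4 * y := by exact_mod_cast h1
          have h2' : (W.card : ℝ) ≤ 4 * z := by exact_mod_cast h2
          have : (W.card : ℝ) * W.card ≤ (4 * y) * (4 * z) :=
            mul_le_mul h1' h2' (by positivity) (by positivity)
          refine Real.exp_le_exp.2 ?_
          nlinarith
  calc bernoulliProb (pairs V) p (fun S₂ => ∃ X, Balanced W X ∧
        crossCount (fromEdgeSet ((S₁ ∪ S₂ : Finset _) : Set (Sym2 V))) X Xᶜ ≤ m)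
      ≤ bernoulliProb (pairs V) p (fun S₂ => ∃ q ∈ J, (S₂ ∩ crossPairs
          (W.filter fun v => g v ∈ q.1) (W.filter fun v => g v ∈ q.2)).card ≤ m) :=
        bernoulliProb_mono hp0 hp1 hcover
    _ ≤ ∑ q ∈ J, bernoulliProb (pairs V) p (fun S₂ => (S₂ ∩ crossPairs
          (W.filter fun v => g v ∈ q.1) (W.filter fun v => g v ∈ q.2)).card ≤ m) :=
        bernoulliProb_exists_le J _ hp0 hp1
    _ ≤ J.card * (2 ^ m * Real.exp (-(p * W.card ^ 2 / 32))) := by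
        rw [← nsmul_eq_mul]
        exact sum_le_card_nsmul _ _ _ hterm
    _ ≤ 4 ^ I.card * (2 ^ m * Real.exp (-(p * W.card ^ 2 / 32))) := by
        gcongr
        have : J.card ≤ 2 ^ I.card * 2 ^ I.card := by
          refine (card_filter_le _ _).trans ?_
          rw [card_product, card_powerset]
        calc (J.card : ℝ) ≤ 2 ^ I.card * 2 ^ I.card := by exact_mod_cast this
          _ = 4 ^ I.card := by rw [← mul_pow]; norm_num
    _ = _ := by ring

/-- `G` has a set of at least `w` vertices all of whose balanced cuts have more than `m` edges. -/
def HasRobustSet (G : SimpleGraph V) (w m : ℕ) : Prop :=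
  ∃ W : Finset V, w ≤ W.card ∧ ∀ X, Balanced W X → m < crossCount G X Xᶜ

/-- The candidate `W` depends on the first round only, so the second is independent of it; `B` must
be uniform in the size `x` of `W` and the number `M` of groups. -/
lemma bernoulliProb_not_hasRobustSet_le {p p₁ p₂ B : ℝ} (hp₁0 : 0 ≤ p₁) (hp₁1 : p₁ ≤ 1)
    (hp₂0 : 0 ≤ p₂) (hp₂1 : p₂ ≤ 1) (hp : 1 - p = (1 - p₁) * (1 - p₂)) {s m w : ℕ} (hs : 0 < s)
    (hm : 24 * m * s ≤ w) (hB0 : 0 ≤ B)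
    (hB : ∀ x M : ℕ, w ≤ x → s * M ≤ 3 * x →
      4 ^ M * 2 ^ m * Real.exp (-(p₂ * x ^ 2 / 32)) ≤ B) :
    bernoulliProb (pairs V) p (fun S => ¬ HasRobustSet (fromEdgeSet (S : Set (Sym2 V))) w m) ≤
      bernoulliProb (pairs V) p₁
        (fun S => (bigVerts (fromEdgeSet (S : Set (Sym2 V))) s).card < w) + B := by
  rw [bernoulliProb, bernoulliExp_sprinkle hp]
  calc _ ≤ bernoulliExp (pairs V) p₁ (fun S => Set.indicator
          {S : Finset (Sym2 V) | (bigVerts (fromEdgeSet (S : Set (Sym2 V))) s).card < w} 1 S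
            + B) := by
        refine bernoulliExp_mono hp₁0 hp₁1 fun S₁ _ => ?_
        by_cases h : (bigVerts (fromEdgeSet (S₁ : Set (Sym2 V))) s).card < w
        · rw [Set.indicator_of_mem (by exact h), Pi.one_apply]
          have := bernoulliProb_le_one (E := pairs V) (p := p₂)
            (P := fun T => ¬ HasRobustSet (fromEdgeSet ((S₁ ∪ T : Finset _) : Set (Sym2 V))) w m)
            hp₂0 hp₂1
          have h' : bernoulliExp (pairs V) p₂ (fun T => Set.indicator
              {S : Finset (Sym2 V) | ¬ HasRobustSet (fromEdgeSet (S : Set (Sym2 V))) w m} 1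
                (S₁ ∪ T)) ≤ 1 := this
          linarith
        · rw [Set.indicator_of_notMem (by exact h), zero_add]
          rw [not_lt] at h
          obtain ⟨M, hM, hprob⟩ := bernoulliProb_small_cut_le hp₂0 hp₂1 S₁ hs (hm.trans h)
          refine le_trans ?_ (hprob.trans (hB _ M h hM))
          refine bernoulliProb_mono hp₂0 hp₂1 (P := fun T =>
            ¬ HasRobustSet (fromEdgeSet ((S₁ ∪ T : Finset _) : Set (Sym2 V))) w m) fun T _ hT => ?_
          by_contra! hcon
          exact hT ⟨_, h, hcon⟩
    _ = _ := by rw [bernoulliExp_add, bernoulliExp_const, bernoulliProb]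

/-! ### Edges at vertices of large degree -/

/-- The pairs that meet `K`. -/
def touching (K : Finset V) : Finset (Sym2 V) := (pairs V).filter fun e => ∃ v ∈ K, v ∈ e

lemma card_touching_le (K : Finset V) : (touching K).card ≤ K.card * Fintype.card V := by
  have hsub : touching K ⊆ K.biUnion fun v => univ.image fun u => s(v, u) := by
    intro e he
    obtain ⟨v, hv, u, rfl⟩ := (mem_filter.1 he).2
    exact mem_biUnion.2 ⟨v, hv, mem_image_of_mem _ (mem_univ u)⟩
  exact (card_le_card hsub).trans (card_biUnion_le_card_mul _ _ _ fun v _ => card_image_le)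

/-- Union bound over `K` and the Chernoff bound at `z = e`, with `1 - p + p * e ≤ exp (2 * p)`. -/
lemma bernoulliProb_touching_le {p : ℝ} (hp0 : 0 ≤ p) (hp1 : p ≤ 1) (k t : ℕ) :
    bernoulliProb (pairs V) p (fun S => ∃ K : Finset V, K.card = k ∧ t ≤ (S ∩ touching K).card) ≤
      (Fintype.card V).choose k * Real.exp (2 * p * (k * Fintype.card V) - t) := by
  have hterm : ∀ K ∈ (univ : Finset V).powersetCard k,
      bernoulliProb (pairs V) p (fun S => t ≤ (S ∩ touching K).card) ≤
        Real.exp (2 * p * (k * Fintype.card V) - t) := by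
    intro K hK
    have he1 : (1 : ℝ) ≤ Real.exp 1 := Real.one_le_exp zero_le_one
    have he3 : Real.exp 1 ≤ 3 := by linarith [Real.exp_one_lt_d9]
    refine (bernoulliProb_le_card_inter hp0 hp1 (filter_subset _ _) he1 t).trans ?_
    have hc : (touching K).card ≤ k * Fintype.card V := by
      rw [← (mem_powersetCard.1 hK).2]
      exact card_touching_le K
    rw [Real.exp_sub, ← Real.exp_nat_mul 1 t, mul_one]
    gcongr
    calc (1 - p + p * Real.exp 1) ^ (touching K).card
        ≤ (1 - p + p * Real.exp 1) ^ (k * Fintype.card V) :=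
          pow_le_pow_right₀ (by nlinarith) hc
      _ ≤ Real.exp (2 * p) ^ (k * Fintype.card V) := by
          refine pow_le_pow_left₀ (by nlinarith) ?_ _
          have := Real.add_one_le_exp (2 * p)
          nlinarith
      _ = Real.exp (2 * p * (k * Fintype.card V)) := by
          rw [← Real.exp_nat_mul]
          push_cast
          ring_nf
  calc bernoulliProb (pairs V) p
        (fun S => ∃ K : Finset V, K.card = k ∧ t ≤ (S ∩ touching K).card)
      ≤ bernoulliProb (pairs V) p (fun S => ∃ K ∈ (univ : Finset V).powersetCard k,
          t ≤ (S ∩ touching K).card) := by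
        refine bernoulliProb_mono hp0 hp1 ?_
        rintro S - ⟨K, hK, h⟩
        exact ⟨K, mem_powersetCard.2 ⟨subset_univ _, hK⟩, h⟩
    _ ≤ ∑ K ∈ (univ : Finset V).powersetCard k,
          bernoulliProb (pairs V) p (fun S => t ≤ (S ∩ touching K).card) :=
        bernoulliProb_exists_le _ (fun (K : Finset V) S => t ≤ (S ∩ touching K).card) hp0 hp1
    _ ≤ ((univ : Finset V).powersetCard k).card • Real.exp (2 * p * (k * Fintype.card V) - t) :=
        sum_le_card_nsmul _ _ _ hterm
    _ = _ := by rw [card_powersetCard, card_univ, nsmul_eq_mul]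

section Deterministic

variable {S : Finset (Sym2 V)} {k d : ℕ}

lemma sum_degree_le (S : Finset (Sym2 V)) (K : Finset V) :
    ∑ v ∈ K, ((fromEdgeSet (S : Set (Sym2 V))).neighborSet v).ncard ≤
      2 * (S ∩ touching K).card := by
  classical
  set G := fromEdgeSet (S : Set (Sym2 V))
  set P : Finset (V × V) := (K ×ˢ univ).filter fun e => G.Adj e.1 e.2
  have hsum : ∑ v ∈ K, (G.neighborSet v).ncard = P.card := by
    simp only [P, card_filter, sum_product]
    refine sum_congr rfl fun v _ => ?_
    rw [← card_filter, ← Set.ncard_coe_finset]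
    congr 1
    ext u
    simp
  rw [hsum]
  refine card_le_mul_card_image_of_maps_to (f := fun e : V × V => s(e.1, e.2)) ?_ 2 ?_
  · rintro ⟨a, b⟩ he
    obtain ⟨h1, h2⟩ := mem_filter.1 he
    simp only at h2
    rw [fromEdgeSet_adj] at h2
    rw [mem_inter]
    exact ⟨h2.1, mem_filter.2 ⟨mem_pairs.2 h2.2, a, (mem_product.1 h1).1, Sym2.mem_mk_left a b⟩⟩
  · intro e _
    induction e using Sym2.ind with
    | _ a b =>
      refine (card_le_card (t := {(a, b), (b, a)}) fun x hx => ?_).trans card_le_two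
      obtain ⟨c, d⟩ := x
      have := (mem_filter.1 hx).2
      simpa [Sym2.eq_iff] using this

/-- `k` vertices of degree above `2 * d` would meet more than `d * k` edges, each edge being counted
at most twice. -/
lemma card_high_lt (hS : ∀ K : Finset V, K.card = k → (S ∩ touching K).card ≤ d * k)
    (hk : 0 < k) {H : Finset V}
    (hH : ∀ v ∈ H, 2 * d < ((fromEdgeSet (S : Set (Sym2 V))).neighborSet v).ncard) :
    H.card < k := by
  by_contra! hcon
  obtain ⟨K, hKH, hK⟩ := exists_subset_card_eq hcon
  have h1 : ∑ v ∈ K, 2 * d < ∑ v ∈ K, ((fromEdgeSet (S : Set (Sym2 V))).neighborSet v).ncard :=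
    sum_lt_sum_of_nonempty (card_pos.1 (hK ▸ hk)) fun v hv => hH v (hKH hv)
  have h2 := h1.trans_le ((sum_degree_le S K).trans (Nat.mul_le_mul_left 2 (hS K hK)))
  rw [sum_const, hK, smul_eq_mul] at h2
  nlinarith

/-- Few edges touch any `k` vertices, so that vertices of large degree may be ignored. -/
lemma crossCount_le_cutRank (hS : ∀ K : Finset V, K.card = k → (S ∩ touching K).card ≤ d * k)
    (hk : 0 < k) (hkV : k ≤ Fintype.card V) (X : Finset V) :
    crossCount (fromEdgeSet (S : Set (Sym2 V))) X Xᶜ ≤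
      d * k + (2 * d) ^ 2 * (fromEdgeSet (S : Set (Sym2 V))).cutRank (X : Set V) (X : Set V)ᶜ := by
  classical
  set G := fromEdgeSet (S : Set (Sym2 V))
  set H := univ.filter fun v => 2 * d < (G.neighborSet v).ncard with hHdef
  have hHk : H.card < k := card_high_lt hS hk fun v hv => (mem_filter.1 hv).2
  -- `hS` speaks of sets of size exactly `k`, so `H` is padded.
  obtain ⟨K, hHK, hK⟩ := exists_superset_card_eq hHk.le hkV
  have hlow : ∀ v, v ∉ K → (G.neighborSet v).ncard ≤ 2 * d := fun v hv => by
    by_contra! h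
    exact hv (hHK (mem_filter.2 ⟨mem_univ _, h⟩))
  have hrank := (G.ncard_le_cutRank ((X : Set V) \ K) ((X : Set V)ᶜ \ K)
    (fun v hv => hlow v hv.2) (fun v hv => hlow v hv.2)).trans
      (Nat.mul_le_mul_left _ (G.cutRank_mono Set.sdiff_subset Set.sdiff_subset))
  have hhigh : {e : V × V | (e.1 ∈ X ∧ e.2 ∈ Xᶜ ∧ G.Adj e.1 e.2) ∧ (e.1 ∈ K ∨ e.2 ∈ K)}.ncard ≤
      d * k := by
    refine le_trans ?_ (hS K hK)
    rw [← Set.ncard_coe_finset]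
    have hinj : Set.InjOn (fun e : V × V => s(e.1, e.2))
        {e : V × V | (e.1 ∈ X ∧ e.2 ∈ Xᶜ ∧ G.Adj e.1 e.2) ∧ (e.1 ∈ K ∨ e.2 ∈ K)} := by
      refine Set.InjOn.mono ?_ (injOn_crossPairs (Y := X) (Z := Xᶜ) disjoint_compl_right)
      exact fun e he => ⟨he.1.1, he.1.2.1⟩
    refine Set.ncard_le_ncard_of_injOn (fun e : V × V => s(e.1, e.2)) ?_ hinj (Set.toFinite _)
    rintro ⟨a, b⟩ ⟨⟨-, -, hab⟩, hK'⟩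
    rw [fromEdgeSet_adj] at hab
    rw [mem_coe, mem_inter]
    refine ⟨hab.1, mem_filter.2 ⟨mem_pairs.2 hab.2, ?_⟩⟩
    rcases hK' with h | h
    · exact ⟨a, h, Sym2.mem_mk_left a b⟩
    · exact ⟨b, h, Sym2.mem_mk_right a b⟩
  refine le_trans ?_ (Nat.add_le_add hhigh hrank)
  refine (Set.ncard_le_ncard ?_ (Set.toFinite _)).trans (Set.ncard_union_le _ _)
  rintro ⟨a, b⟩ ⟨ha, hb, hab⟩
  by_cases h : a ∈ K ∨ b ∈ K
  · exact Or.inl ⟨⟨ha, hb, hab⟩, h⟩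
  · rw [not_or] at h
    rw [mem_compl] at hb
    exact Or.inr ⟨⟨ha, h.1⟩, ⟨hb, h.2⟩, hab⟩

end Deterministic

/-- An optimal decomposition has an edge cutting the robust set in a balanced way; the many edges of
this cut force large cut-rank. -/
lemma HasRobustSet.lt_rankWidth {n k d w m : ℕ} (hn : 2 ≤ n) {S : Finset (Sym2 (Fin n))}
    (hR : HasRobustSet (fromEdgeSet (S : Set (Sym2 (Fin n)))) w m) (hw : 3 ≤ w)
    (hS : ∀ K : Finset (Fin n), K.card = k → (S ∩ touching K).card ≤ d * k) (hk : 0 < k)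
    (hkn : k ≤ n) :
    m < d * k + (2 * d) ^ 2 * (fromEdgeSet (S : Set (Sym2 (Fin n)))).rankWidth := by
  classical
  obtain ⟨W, hwW, hW⟩ := hR
  set G := fromEdgeSet (S : Set (Sym2 (Fin n)))
  obtain ⟨D, hD⟩ := RankDecomposition.exists_width_eq_rankWidth hn G
  obtain ⟨u, v, huv, h1, h2⟩ := D.exists_balanced W (hw.trans hwW)
  set X : Finset (Fin n) := univ.filter fun x => x ∈ D.side u v
  have hX : (X : Set (Fin n)) = D.side u v := by
    ext x
    simp [X]
  have hbal : Balanced W X := by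
    refine ⟨h1.trans_eq ?_, h2.trans_eq ?_⟩ <;> congr 2 <;> ext x <;> simp [X]
  have h3 := (hW X hbal).trans_le (crossCount_le_cutRank hS hk (by simpa using hkn) X)
  rw [hX, ← D.side_swap huv] at h3
  rw [← hD]
  have h4 := D.cutRank_le_width G huv
  calc m < _ := h3
    _ ≤ _ := by gcongr

end SimpleGraph

/-! ### Choice of parameters and numerical estimates -/

namespace SimpleGraph

open Finset

lemma exp_neg_le_one_sub {x : ℝ} (hx0 : 0 ≤ x) (hx1 : x ≤ 1 / 2) :
    Real.exp (-(x + x ^ 2)) ≤ 1 - x := by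
  have h := Real.quadratic_le_exp_of_nonneg (show 0 ≤ x + x ^ 2 by positivity)
  rw [Real.exp_neg]
  have hpos : 0 < 1 + (x + x ^ 2) + (x + x ^ 2) ^ 2 / 2 := by positivity
  refine (inv_anti₀ hpos h).trans ?_
  rw [inv_le_iff_one_le_mul₀ hpos]
  have h2 : 0 ≤ 1 - x - x ^ 2 - x ^ 3 := by
    have h3 : x ^ 2 ≤ (1 / 2) ^ 2 := by gcongr
    have h4 : x ^ 3 ≤ (1 / 2) ^ 3 := by gcongr
    linarith
  have h3 := mul_nonneg (sq_nonneg x) h2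
  linarith

/-- Bounds the ratio of `n.choose a` to `m.choose a` by `(n / (m + 1 - a)) ^ a`, without division.
-/
lemma pow_mul_choose_le {n m a : ℕ} (ham : a ≤ m + 1) :
    ((m : ℝ) + 1 - a) ^ a * n.choose a ≤ n ^ a * m.choose a := by
  have hfac : (0 : ℝ) < a.factorial := by exact_mod_cast a.factorial_pos
  have h1 : (n.choose a : ℝ) * a.factorial ≤ n ^ a := by
    have := Nat.descFactorial_le_pow n a
    rw [Nat.descFactorial_eq_factorial_mul_choose, mul_comm] at this
    exact_mod_cast this
  have h2 : ((m : ℝ) + 1 - a) ^ a ≤ (m.choose a : ℝ) * a.factorial := by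
    have := Nat.pow_sub_le_descFactorial m a
    rw [Nat.descFactorial_eq_factorial_mul_choose, mul_comm] at this
    calc ((m : ℝ) + 1 - a) ^ a = (((m + 1 - a) ^ a : ℕ) : ℝ) := by
          push_cast [Nat.cast_sub ham]
          rfl
      _ ≤ _ := by exact_mod_cast this
  calc ((m : ℝ) + 1 - a) ^ a * n.choose a ≤ m.choose a * a.factorial * n.choose a := by gcongr
    _ = (n.choose a * a.factorial) * m.choose a := by ring
    _ ≤ n ^ a * m.choose a := by gcongr

/-- Shows that `η = 1 - ε / 4` is admissible in `bernoulliProb_confined_le`: after `b` vertices are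
used up, the mean offspring is still at least `(1 + ε / 2) * (1 - ε / 8) ≥ 1 + ε / 4`. -/
lemma one_sub_pow_le {ε p b : ℝ} {n N : ℕ} (hε0 : 0 < ε) (hε1 : ε ≤ 1 / 2) (hp0 : 0 ≤ p)
    (hp1 : p ≤ 1) (hpn : 1 + ε / 2 ≤ p * n) (hb : b ≤ ε * n / 8) (hN : (N : ℝ) = n - b) :
    (1 - p + p * (1 - ε / 4)) ^ N ≤ 1 - ε / 4 := by
  have hbase : 1 - p + p * (1 - ε / 4) = 1 - p * (ε / 4) := by ring
  have h1 : 1 - p + p * (1 - ε / 4) ≤ Real.exp (-(p * (ε / 4))) := by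
    have := Real.add_one_le_exp (-(p * (ε / 4)))
    linarith
  have h0 : 0 ≤ 1 - p + p * (1 - ε / 4) := by
    have : p * (ε / 4) ≤ 1 * 1 := by
      gcongr
      linarith
    linarith
  refine (pow_le_pow_left₀ h0 h1 _).trans ?_
  rw [← Real.exp_nat_mul, hN]
  refine le_trans (Real.exp_le_exp.2 ?_)
    (exp_neg_le_one_sub (x := ε / 4) (by linarith) (by linarith))
  have h2 : p * (n * (1 - ε / 8)) ≤ p * (n - b) := by
    gcongr
    linarith
  have h3 : (1 + ε / 2) * (1 - ε / 8) ≤ p * n * (1 - ε / 8) := by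
    gcongr
    linarith
  have h5 : (1 + ε / 2) * (1 - ε / 8) = 1 + ε / 4 + ε * (2 - ε) / 16 := by ring
  have h6 : 0 ≤ ε * (2 - ε) := mul_nonneg hε0.le (by linarith)
  have h4 : 1 + ε / 4 ≤ p * (n - b) := by linarith
  have h7 := mul_le_mul_of_nonneg_left h4 (show 0 ≤ ε / 4 by linarith)
  linarith

/-- In the barely supercritical regime many vertices lie in big components. -/
lemma bernoulliProb_card_bigVerts_lt_ceil_le {n s : ℕ} {ε p : ℝ} (hε0 : 0 < ε) (hε1 : ε ≤ 1 / 2)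
    (hp0 : 0 ≤ p) (hp1 : p ≤ 1) (hn : 0 < n) (hpn : 1 + ε / 2 ≤ p * n) (hs : 16 ≤ s) :
    bernoulliProb (pairs (Fin n)) p (fun S =>
      (bigVerts (fromEdgeSet (S : Set (Sym2 (Fin n)))) s).card < ⌈ε * n / 8⌉₊) ≤
        (1 - ε / 16) ^ ⌊ε * n / (8 * s)⌋₊ := by
  -- Chosen so that the exploration uses at most `a * s ≤ ε * n / 8` vertices.
  set a := ⌊ε * n / (8 * s)⌋₊
  set w := ⌈ε * n / 8⌉₊
  have hn' : (0 : ℝ) < n := by exact_mod_cast hn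
  have hs' : (16 : ℝ) ≤ s := by exact_mod_cast hs
  have hs0 : (0 : ℝ) < s := by linarith
  have ha : (a : ℝ) ≤ ε * n / (8 * s) := Nat.floor_le (by positivity)
  have has : (a : ℝ) * s ≤ ε * n / 8 := by
    rw [le_div_iff₀ (by positivity)] at ha
    linarith
  have ha16 : (a : ℝ) ≤ ε * n / 128 := by nlinarith [Nat.cast_nonneg (α := ℝ) a]
  have hεn : ε * n ≤ n := by nlinarith
  have hasn : a * s ≤ n := by
    have : ((a * s : ℕ) : ℝ) ≤ n := by push_cast; linarith
    exact_mod_cast this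
  have hw : (w : ℝ) < ε * n / 8 + 1 := Nat.ceil_lt_add_one (by positivity)
  have hwn : w ≤ n := Nat.ceil_le.2 (by linarith)
  obtain ⟨m, hm⟩ : ∃ m, m + w = n + 1 := ⟨n + 1 - w, by omega⟩
  have hm' : (m : ℝ) + w = n + 1 := by exact_mod_cast hm
  have hmlow : n - ε * n / 8 ≤ (m : ℝ) := by linarith
  set η := 1 - ε / 4 with hη
  have hn₀ : (1 - p + p * η) ^ (n - a * s) ≤ η :=
    one_sub_pow_le hε0 hε1 hp0 hp1 hpn has (by rw [Nat.cast_sub hasn]; push_cast; rfl)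
  have hmain := bernoulliProb_card_bigVerts_lt (V := Fin n) hp0 hp1 (η := η) (by linarith)
    (by linarith) hn₀ (a := a) (s := s) (m := m) (by rw [Fintype.card_fin]; omega)
  rw [Fintype.card_fin] at hmain
  set P := bernoulliProb (pairs (Fin n)) p
      (fun S => m ≤ (bigVerts (fromEdgeSet (S : Set (Sym2 (Fin n)))) s)ᶜ.card)
  have hle : bernoulliProb (pairs (Fin n)) p (fun S =>
      (bigVerts (fromEdgeSet (S : Set (Sym2 (Fin n)))) s).card < w) ≤ P := by
    refine bernoulliProb_mono hp0 hp1 fun S _ h => ?_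
    rw [card_compl, Fintype.card_fin]
    omega
  refine hle.trans ?_
  -- As `s ≥ 16` gives `a ≤ ε * n / 128`, the loss from `n` to `m + 1 - a` is outweighed by `η`.
  have hb : (1 - ε / 4) * n ≤ (1 - ε / 16) * (m + 1 - a) := by
    have h5 : n * (1 - 17 * ε / 128) ≤ (m : ℝ) + 1 - a := by linarith
    have h6 := mul_le_mul_of_nonneg_left h5 (show 0 ≤ 1 - ε / 16 by linarith)
    have h7 : 0 ≤ (ε * n) * (7 / 128 + 17 / 2048 * ε) := by positivity
    linarith
  have ham : a ≤ m + 1 := by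
    have : (a : ℝ) ≤ m + 1 := by nlinarith
    exact_mod_cast this
  have hpos : 0 < (m : ℝ) + 1 - a := by
    by_contra! hcon
    have h7 : 0 < (1 - ε / 4) * n := mul_pos (by linarith) hn'
    have h8 : (1 - ε / 16) * (m + 1 - a) ≤ 0 :=
      mul_nonpos_of_nonneg_of_nonpos (by linarith) hcon
    linarith
  have hη0 : 0 ≤ η := by linarith
  have hchoose : (0 : ℝ) < m.choose a := by
    have hm1 : a < m + 1 := by
      have : (a : ℝ) < m + 1 := by linarith
      exact_mod_cast this
    exact_mod_cast Nat.choose_pos (Nat.lt_succ_iff.1 hm1)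
  refine le_of_mul_le_mul_left ?_ (mul_pos (pow_pos hpos a) hchoose)
  calc ((m : ℝ) + 1 - a) ^ a * m.choose a * P
      = ((m : ℝ) + 1 - a) ^ a * (m.choose a * P) := by ring
    _ ≤ ((m : ℝ) + 1 - a) ^ a * (n.choose a * η ^ a) := by gcongr
    _ = (((m : ℝ) + 1 - a) ^ a * n.choose a) * η ^ a := by ring
    _ ≤ (n ^ a * m.choose a) * η ^ a :=
        mul_le_mul_of_nonneg_right (pow_mul_choose_le ham) (pow_nonneg hη0 a)
    _ = (η * n) ^ a * m.choose a := by rw [mul_pow]; ring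
    _ ≤ ((1 - ε / 16) * (m + 1 - a)) ^ a * m.choose a := by
        refine mul_le_mul_of_nonneg_right ?_ hchoose.le
        exact pow_le_pow_left₀ (mul_nonneg hη0 hn'.le) hb a
    _ = _ := by rw [mul_pow]; ring

/-- A single term of the expansion of `(x + 1) ^ n`. -/
lemma choose_mul_pow_le_exp (n k : ℕ) {x : ℝ} (hx : 0 ≤ x) :
    (n.choose k : ℝ) * x ^ k ≤ Real.exp (x * n) := by
  rcases lt_or_ge n k with h | h
  · rw [Nat.choose_eq_zero_of_lt h]
    simpa using (Real.exp_pos _).le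
  · have h1 : (n.choose k : ℝ) * x ^ k ≤ (x + 1) ^ n := by
      rw [add_pow]
      simp only [one_pow, mul_one]
      refine le_trans (le_of_eq (mul_comm _ _)) (single_le_sum
        (f := fun i => x ^ i * (n.choose i : ℝ)) (fun i _ => by positivity)
        (mem_range.2 (Nat.lt_succ_of_le h)))
    refine h1.trans ((pow_le_pow_left₀ (by linarith) (Real.add_one_le_exp x) n).trans ?_)
    rw [← Real.exp_nat_mul, mul_comm]

/-- Any `ε ^ 4 * n` vertices meet few edges. -/
lemma bernoulliProb_lt_touching_le {n k d : ℕ} {ε p : ℝ} (hε0 : 0 < ε) (hp0 : 0 ≤ p) (hp1 : p ≤ 1)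
    (hpn : p * n ≤ 2) (hk : ε ^ 4 * n ≤ k) (hd : 6 + 4 * Real.log (1 / ε) ≤ d) :
    bernoulliProb (pairs (Fin n)) p (fun S => ∃ K : Finset (Fin n), K.card = k ∧
      d * k + 1 ≤ (S ∩ touching K).card) ≤ Real.exp (-(ε ^ 4 * n)) := by
  refine (bernoulliProb_touching_le hp0 hp1 k (d * k + 1)).trans ?_
  rw [Fintype.card_fin]
  have hx : 0 < ε ^ 4 := by positivity
  have h1 := choose_mul_pow_le_exp n k hx.le
  have h2 : (ε ^ 4) ^ k = Real.exp (-(4 * Real.log (1 / ε) * k)) := by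
    rw [one_div, Real.log_inv, ← Real.exp_log hε0, Real.log_exp, ← Real.exp_nat_mul,
      ← Real.exp_nat_mul]
    congr 1
    push_cast
    ring
  rw [h2, ← le_div_iff₀ (Real.exp_pos _), ← Real.exp_sub] at h1
  refine (mul_le_mul_of_nonneg_right h1 (Real.exp_pos _).le).trans ?_
  rw [← Real.exp_add]
  refine Real.exp_le_exp.2 ?_
  push_cast
  have hk0 : (0 : ℝ) ≤ k := Nat.cast_nonneg k
  have h3 : 2 * p * (k * n) ≤ 4 * k := by nlinarith
  -- The logarithm pays for the choice of `K`, `4` for the Chernoff factor, and `2` turns `ε ^ 4 *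
  -- n` into its negative.
  have h4 : (6 + 4 * Real.log (1 / ε)) * k ≤ d * k := by gcongr
  nlinarith

/-- In the barely supercritical regime there is a robust set. -/
lemma bernoulliProb_not_hasRobustSet_exp_le {n s m : ℕ} {ε : ℝ} (hε0 : 0 < ε) (hε1 : ε ≤ 1 / 2)
    (hn : 2 ≤ n) (hs1 : 16384 / ε ^ 2 ≤ s) (hs2 : s ≤ 32768 / ε ^ 2)
    (hm : m ≤ ε ^ 3 * n / 6291456) :
    bernoulliProb (pairs (Fin n)) ((1 + ε) / n) (fun S =>
      ¬ HasRobustSet (fromEdgeSet (S : Set (Sym2 (Fin n)))) ⌈ε * n / 8⌉₊ m) ≤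
        (1 - ε / 16) ^ ⌊ε * n / (8 * s)⌋₊ + Real.exp (-(ε ^ 3 * n / 8192)) := by
  have hn' : (2 : ℝ) ≤ n := by exact_mod_cast hn
  have hn0 : (0 : ℝ) < n := by linarith
  have hε2 : 0 < ε ^ 2 := by positivity
  have hs16 : 16 ≤ s := by
    have h1 : (16 : ℝ) ≤ 16384 / ε ^ 2 := by
      rw [le_div_iff₀ hε2]
      nlinarith
    exact_mod_cast h1.trans hs1
  have hs0 : (0 : ℝ) < s := by exact_mod_cast (by omega : 0 < s)
  set p₂ : ℝ := ε / (2 * n) with hp₂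
  have hp₂0 : 0 ≤ p₂ := by positivity
  have hp₂1 : p₂ < 1 := by
    rw [hp₂, div_lt_one (by positivity)]
    linarith
  have hden : 0 < 1 - p₂ := by linarith
  set p₁ : ℝ := ((1 + ε) / n - p₂) / (1 - p₂) with hp₁
  have hnum : (1 + ε) / n - p₂ = (1 + ε / 2) / n := by
    rw [hp₂]
    field_simp
    ring
  have hp₁0 : 0 ≤ p₁ := by
    rw [hp₁, hnum]
    positivity
  have hp1 : (1 + ε) / n ≤ 1 := by
    rw [div_le_one hn0]
    linarith
  have hp₁1 : p₁ ≤ 1 := by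
    rw [hp₁, div_le_one hden]
    linarith
  have hp₁n : 1 + ε / 2 ≤ p₁ * n := by
    have : (1 + ε / 2) / n ≤ p₁ := by
      rw [hp₁, hnum, le_div_iff₀ hden]
      have : 0 ≤ (1 + ε / 2) / n := by positivity
      nlinarith
    rwa [div_le_iff₀ hn0] at this
  have hw : ε * n / 8 ≤ (⌈ε * n / 8⌉₊ : ℝ) := Nat.le_ceil _
  have hsε : (s : ℝ) * ε ^ 2 ≤ 32768 := by rwa [le_div_iff₀ hε2] at hs2
  have hsε' : 16384 ≤ (s : ℝ) * ε ^ 2 := by rwa [div_le_iff₀ hε2] at hs1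
  refine (bernoulliProb_not_hasRobustSet_le (p₁ := p₁) (p₂ := p₂)
    (B := Real.exp (-(ε ^ 3 * n / 8192))) hp₁0 hp₁1 hp₂0 hp₂1.le ?_ (s := s) (by omega) ?_
    (Real.exp_pos _).le ?_).trans ?_
  · rw [hp₁]
    field_simp
    ring
  -- `6291456 = 8 * 24 * 32768` is exactly what `24 * m * s ≤ ε * n / 8` requires.
  · have h1 : (m : ℝ) * s ≤ ε ^ 3 * n / 6291456 * s := by gcongr
    have h2 : ε ^ 3 * n / 6291456 * s = (ε * n / 6291456) * (s * ε ^ 2) := by ring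
    have h3 : (ε * n / 6291456) * (s * ε ^ 2) ≤ (ε * n / 6291456) * 32768 := by gcongr
    have : ((24 * m * s : ℕ) : ℝ) ≤ (⌈ε * n / 8⌉₊ : ℝ) := by
      push_cast
      linarith
    exact_mod_cast this
  · intro x M hx hM
    have hx' : ε * n / 8 ≤ (x : ℝ) := hw.trans (by exact_mod_cast hx)
    have hM' : (s : ℝ) * M ≤ 3 * x := by exact_mod_cast hM
    have h4 : (4 : ℝ) ^ M ≤ Real.exp (2 * M) := by
      have : (4 : ℝ) ≤ Real.exp 2 := by
        have := Real.quadratic_le_exp_of_nonneg (show (0 : ℝ) ≤ 2 by norm_num)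
        linarith
      refine (pow_le_pow_left₀ (by norm_num) this M).trans_eq ?_
      rw [← Real.exp_nat_mul, mul_comm]
    have h2 : (2 : ℝ) ^ m ≤ Real.exp m := by
      have : (2 : ℝ) ≤ Real.exp 1 := by linarith [Real.add_one_le_exp 1]
      refine (pow_le_pow_left₀ (by norm_num) this m).trans_eq ?_
      rw [← Real.exp_nat_mul, mul_one]
    calc (4 : ℝ) ^ M * 2 ^ m * Real.exp (-(p₂ * x ^ 2 / 32))
        ≤ Real.exp (2 * M) * Real.exp m * Real.exp (-(p₂ * x ^ 2 / 32)) := by gcongr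
      _ = Real.exp (2 * M + m + -(p₂ * x ^ 2 / 32)) := by rw [Real.exp_add, Real.exp_add]
      _ ≤ _ := by
        refine Real.exp_le_exp.2 ?_
        -- In units of `ε ^ 2 * x`, the gain is `1 / 512`; the groups cost `3 / 8192`, `m` far less,
        -- and the target needs at most `1 / 1024`.
        have h5 : ε ^ 2 * x / 512 ≤ p₂ * x ^ 2 / 32 := by
          have : p₂ * x ^ 2 / 32 = ε * x / (64 * n) * x := by
            rw [hp₂]
            field_simp
            ring
          rw [this]
          have h6 : ε ^ 2 / 512 * x ≤ ε * x / (64 * n) * x := by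
            refine mul_le_mul_of_nonneg_right ?_ (Nat.cast_nonneg x)
            rw [div_le_div_iff₀ (by norm_num) (by positivity)]
            nlinarith
          linarith
        have h7 : (M : ℝ) ≤ 3 * x * ε ^ 2 / 16384 := by
          rw [le_div_iff₀ (by norm_num)]
          calc (M : ℝ) * 16384 ≤ M * (s * ε ^ 2) := by gcongr
            _ = (s * M) * ε ^ 2 := by ring
            _ ≤ 3 * x * ε ^ 2 := by gcongr
        have h8 : ε ^ 3 * n ≤ 8 * (x * ε ^ 2) := by
          have : ε ^ 2 * (ε * n / 8) ≤ ε ^ 2 * x := by gcongr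
          nlinarith
        nlinarith
  · gcongr
    exact bernoulliProb_card_bigVerts_lt_ceil_le hε0 hε1 hp₁0 hp₁1 (by omega) hp₁n hs16

lemma mul_log_inv_le {ε : ℝ} (hε : 0 < ε) : ε * Real.log (1 / ε) ≤ 2 * √ε := by
  have hr : 0 < √ε := Real.sqrt_pos.2 hε
  have h1 : Real.log (1 / ε) = 2 * Real.log (1 / √ε) := by
    rw [one_div, one_div, Real.log_inv, Real.log_inv, Real.log_sqrt hε.le]
    ring
  have h2 : Real.log (1 / √ε) ≤ 1 / √ε := by
    have := Real.log_le_sub_one_of_pos (show 0 < 1 / √ε by positivity)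
    linarith
  rw [h1]
  calc ε * (2 * Real.log (1 / √ε)) ≤ ε * (2 * (1 / √ε)) := by gcongr
    _ = 2 * √ε := by
        field_simp
        rw [Real.sq_sqrt hε.le]

/-- The rank-width is large if there is a robust set and few edges at vertices of large degree. -/
lemma HasRobustSet.le_rankWidth {n k d w m : ℕ} {ε c : ℝ} (hε0 : 0 < ε) (hn : 2 ≤ n)
    {S : Finset (Sym2 (Fin n))} (hR : HasRobustSet (fromEdgeSet (S : Set (Sym2 (Fin n)))) w m)
    (hw : 3 ≤ w) (hS : ∀ K : Finset (Fin n), K.card = k → (S ∩ touching K).card ≤ d * k)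
    (hk : 0 < k) (hkn : k ≤ n) (hℓ : 1 ≤ Real.log (1 / ε))
    (hεc : 44 * (ε * Real.log (1 / ε)) ≤ c) (hm : c * (ε ^ 3 * n) ≤ m + 1)
    (hd : d ≤ 11 * Real.log (1 / ε)) (hkε : k ≤ 2 * (ε ^ 4 * n)) :
    c / 968 * (ε ^ 3 / Real.log (1 / ε) ^ 3) * n ≤
      ((fromEdgeSet (S : Set (Sym2 (Fin n)))).rankWidth : ℝ) := by
  have h := hR.lt_rankWidth hn hw hS hk hkn
  set r := (fromEdgeSet (S : Set (Sym2 (Fin n)))).rankWidth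
  set ℓ := Real.log (1 / ε)
  have h' : (m : ℝ) + 1 ≤ d * k + (2 * d) ^ 2 * r := by exact_mod_cast h
  have hn0 : (0 : ℝ) ≤ n := Nat.cast_nonneg n
  have hℓ0 : 0 < ℓ := by linarith
  -- Edges at vertices of large degree take at most half of the cut.
  have h1 : (d : ℝ) * k ≤ c * (ε ^ 3 * n) / 2 := by
    calc (d : ℝ) * k ≤ (11 * ℓ) * (2 * (ε ^ 4 * n)) := by gcongr
      _ = 44 * (ε * ℓ) * (ε ^ 3 * n) / 2 := by ring
      _ ≤ c * (ε ^ 3 * n) / 2 := by gcongr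
  have h2 : (2 * (d : ℝ)) ^ 2 * r ≤ 484 * ℓ ^ 2 * r := by
    have : (2 * (d : ℝ)) ^ 2 ≤ (2 * (11 * ℓ)) ^ 2 := by gcongr
    have h3 : (2 * (11 * ℓ)) ^ 2 = 484 * ℓ ^ 2 := by ring
    rw [h3] at this
    gcongr
  have h3 : c * (ε ^ 3 * n) ≤ 968 * ℓ ^ 2 * r := by linarith
  -- The argument loses only `ℓ ^ 2`; the stated bound is weaker as `ℓ ≥ 1`.
  have h4 : ℓ ^ 2 * r ≤ ℓ ^ 3 * r := by
    gcongr
    norm_num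
  have h5 : c / 968 * (ε ^ 3 / ℓ ^ 3) * n = c * (ε ^ 3 * n) / 968 / ℓ ^ 3 := by ring
  rw [h5, div_le_iff₀ (by positivity)]
  linarith

end SimpleGraph

/-! ### The main theorem -/

open SimpleGraph Finset in
/-- The edge probability `(1 + ε) / n` is projected to `[0, 1]`; this changes nothing once
`1 + ε ≤ n`. -/
theorem theorem1p4 :
    ∃ C : ℝ, 0 < C ∧ ∃ ε₀ : ℝ, 0 < ε₀ ∧ ε₀ < 1 ∧ ∀ ε : ℝ, 0 < ε → ε < ε₀ →
      Tendsto
        (fun n : ℕ =>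
          SimpleGraph.binomialRandom (Fin n) (Set.projIcc (0 : ℝ) 1 zero_le_one ((1 + ε) / n))
            {G : SimpleGraph (Fin n) |
              C * (ε ^ 3 / (Real.log (1 / ε)) ^ 3) * n ≤ (G.rankWidth : ℝ)})
        atTop (𝓝 1) := by
  set c : ℝ := 1 / 6291456 with hc
  -- `968 = 2 * (2 * 11) ^ 2`, from half of the cut and degrees up to `2 * d`. The bound on `ε`
  -- makes `44 * (2 * √ε) ≤ c`.
  refine ⟨c / 968, by positivity, (c / 88) ^ 2, by positivity, by norm_num [hc], fun ε hε0 hε => ?_⟩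
  have hε1 : ε ≤ 1 / 16 := hε.le.trans (by norm_num [hc])
  have hℓ : 1 ≤ Real.log (1 / ε) := by
    rw [Real.le_log_iff_exp_le (by positivity)]
    have h1 : (16 : ℝ) ≤ 1 / ε := by
      rw [le_div_iff₀ hε0]
      linarith
    linarith [Real.exp_one_lt_d9]
  have hεc : 44 * (ε * Real.log (1 / ε)) ≤ c := by
    have h1 := mul_log_inv_le hε0
    have h2 : √ε ≤ c / 88 := by
      rw [Real.sqrt_le_left (by positivity)]
      exact hε.le
    linarith
  set s := ⌈16384 / ε ^ 2⌉₊
  have hs1 : 16384 / ε ^ 2 ≤ s := Nat.le_ceil _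
  have hs2 : (s : ℝ) ≤ 32768 / ε ^ 2 := by
    have h1 : (s : ℝ) < 16384 / ε ^ 2 + 1 := Nat.ceil_lt_add_one (by positivity)
    have h2 : (1 : ℝ) ≤ 16384 / ε ^ 2 := by
      rw [le_div_iff₀ (by positivity)]
      nlinarith
    have h3 : 32768 / ε ^ 2 = 16384 / ε ^ 2 + 16384 / ε ^ 2 := by ring
    linarith
  have hs0 : (0 : ℝ) < s := lt_of_lt_of_le (by positivity) hs1
  -- Since the logarithm is at least `1`, this lies between `6 + 4 * log (1 / ε)` and `11 * log (1 /
  -- ε)`.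
  set d := ⌈10 * Real.log (1 / ε)⌉₊
  have hd1 : 10 * Real.log (1 / ε) ≤ d := Nat.le_ceil _
  have hd2 : (d : ℝ) ≤ 11 * Real.log (1 / ε) := by
    have h1 : (d : ℝ) < 10 * Real.log (1 / ε) + 1 := Nat.ceil_lt_add_one (by positivity)
    linarith
  have hlin : ∀ {b : ℝ}, 0 < b → Tendsto (fun n : ℕ => b * n) atTop atTop := fun hb =>
    tendsto_natCast_atTop_atTop.const_mul_atTop hb
  have hlower : Tendsto (fun n : ℕ => ENNReal.ofReal (1 - ((1 - ε / 16) ^ ⌊ε * n / (8 * s)⌋₊ +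
      Real.exp (-(ε ^ 3 * n / 8192)) + Real.exp (-(ε ^ 4 * n))))) atTop (𝓝 1) := by
    have h1 : Tendsto (fun n : ℕ => (1 - ε / 16) ^ ⌊ε * n / (8 * s)⌋₊) atTop (𝓝 0) := by
      refine (tendsto_pow_atTop_nhds_zero_of_lt_one (by linarith) (by linarith)).comp ?_
      refine tendsto_nat_floor_atTop.comp ((hlin (b := ε / (8 * s)) (by positivity)).congr ?_)
      intro n
      ring
    have h2 : Tendsto (fun n : ℕ => Real.exp (-(ε ^ 3 * n / 8192))) atTop (𝓝 0) := by
      refine Real.tendsto_exp_neg_atTop_nhds_zero.comp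
        ((hlin (b := ε ^ 3 / 8192) (by positivity)).congr fun n => ?_)
      ring
    have h3 : Tendsto (fun n : ℕ => Real.exp (-(ε ^ 4 * n))) atTop (𝓝 0) :=
      Real.tendsto_exp_neg_atTop_nhds_zero.comp (hlin (by positivity))
    have h4 := ENNReal.tendsto_ofReal (((h1.add h2).add h3).const_sub 1)
    simpa using h4
  refine tendsto_of_tendsto_of_tendsto_of_le_of_le' hlower tendsto_const_nhds ?_
    (Eventually.of_forall fun n => prob_le_one)
  -- `24 ≤ ε * n` gives `w ≥ 3`, and `1 ≤ ε ^ 4 * n` gives `k ≤ 2 * (ε ^ 4 * n)`.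
  filter_upwards [eventually_ge_atTop 2, (hlin hε0).eventually_ge_atTop 24,
    (hlin (b := ε ^ 4) (by positivity)).eventually_ge_atTop 1] with n hn hn24 hn4
  have hn' : (2 : ℝ) ≤ n := by exact_mod_cast hn
  have hp0 : 0 ≤ (1 + ε) / n := by positivity
  have hp1 : (1 + ε) / n ≤ 1 := by
    rw [div_le_one (by linarith)]
    linarith
  refine le_trans (ENNReal.ofReal_le_ofReal ?_) (binomialRandom_ge _ _)
  rw [Set.projIcc_of_mem zero_le_one ⟨hp0, hp1⟩]
  simp only
  set m := ⌊c * (ε ^ 3 * n)⌋₊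
  set k := ⌈ε ^ 4 * n⌉₊
  set w := ⌈ε * n / 8⌉₊
  have hk1 : ε ^ 4 * n ≤ k := Nat.le_ceil _
  have hk2 : (k : ℝ) < ε ^ 4 * n + 1 := Nat.ceil_lt_add_one (by positivity)
  have hR := bernoulliProb_not_hasRobustSet_exp_le (m := m) hε0 (by linarith) hn hs1 hs2
    ((Nat.floor_le (by positivity)).trans_eq (by rw [hc]; ring))
  have hT := bernoulliProb_lt_touching_le (n := n) (k := k) (d := d) hε0 hp0 hp1
    (by rw [div_mul_cancel₀ _ (by linarith)]; linarith) hk1 (by linarith)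
  have hkey : bernoulliProb (pairs (Fin n)) ((1 + ε) / n) (fun S =>
      fromEdgeSet (S : Set (Sym2 (Fin n))) ∉ {G : SimpleGraph (Fin n) |
        c / 968 * (ε ^ 3 / (Real.log (1 / ε)) ^ 3) * n ≤ (G.rankWidth : ℝ)}) ≤
      bernoulliProb (pairs (Fin n)) ((1 + ε) / n) (fun S =>
        ¬ HasRobustSet (fromEdgeSet (S : Set (Sym2 (Fin n)))) w m ∨
          ∃ K : Finset (Fin n), K.card = k ∧ d * k + 1 ≤ (S ∩ touching K).card) := by
    refine bernoulliProb_mono hp0 hp1 fun S _ hbad => ?_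
    by_contra! hcon
    refine hbad (hcon.1.le_rankWidth (k := k) (d := d) hε0 hn ?_ ?_ ?_ ?_ hℓ hεc
      (Nat.lt_floor_add_one _).le hd2 (by linarith))
    · have : (3 : ℝ) ≤ w := le_trans (by linarith) (Nat.le_ceil _)
      exact_mod_cast this
    · exact fun K hK => Nat.lt_succ_iff.1 (hcon.2 K hK)
    · exact Nat.ceil_pos.2 (by positivity)
    · refine Nat.ceil_le.2 ?_
      have : ε ^ 4 ≤ 1 := pow_le_one₀ hε0.le (by linarith)
      nlinarith
  have hor := bernoulliProb_or_le (E := pairs (Fin n)) (p := (1 + ε) / n)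
    (P := fun S => ¬ HasRobustSet (fromEdgeSet (S : Set (Sym2 (Fin n)))) w m)
    (Q := fun S => ∃ K : Finset (Fin n), K.card = k ∧ d * k + 1 ≤ (S ∩ touching K).card) hp0 hp1
  linarith
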